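/- Let $\mathbb K$ be a field of characteristic zero and $A$ a commutative unital $\mathbb K$-algebra. Let $\mathbb N^*$ be the set of nonempty words in the positive integers, $\mathbf 1$ the empty word, $V$ the $\mathbb K$-vector space with basis $\mathbb N^*$, and $T(V)=\bigoplus_{n\ge 0}V^{\otimes n}$ its tensor algebra, with product written $|$ and unit $\mathbf 1$. Let $\Delta\colon T(V)\to T(V)\otimes T(V)$ be the algebra morphism with $$\Delta(a_1\cdots a_n)=\sum_{S\subseteq[n]}w_S\otimes w_{J_1^S}|\cdots|w_{J_m^S}\qquad (w=a_1\cdots a_n\in\mathbb N^*),$$ where $w_S$ is the subword of $w$ at the places in $S$ and $J_1^S<\dots<J_m^S$ are the maximal intervals of $[n]\setminus S$. On $\mathrm{Lin}(T(V),A)$ let $\phi*\psi=m_A(\phi\otimes\psi)\Delta$ be the convolution product, with unit $\varepsilon_A$ (the counit followed by $\mathbb K\to A$), and let $\mathcal L(A)$ be the space of infinitesimal characters, i.e. of the linear maps $T(V)\to A$ which vanish on $\mathbf 1$ and on $V^{\otimes n}$ for all $n\ge 2$. Put $\exp^*(\phi)=\sum_{n\ge0}\phi^{*n}/n!$ and $\log^*(\gamma)=\sum_{n\ge1}\frac{(-1)^{n-1}}{n}(\gamma-\varepsilon_A)^{*n}$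 (sums that are finite at each point when $\phi(\mathbf 1)=0$, $\gamma(\mathbf 1)=1$). Let $G^0$ be the set of formal power series $f=\sum_{w\in\mathbb N^*}f_wx_w$ with coefficients in $A$ in the non-commuting variables $x_1,x_2,\dots$ with zero constant coefficient, with the Lie bracket $[f,g]=f\triangleleft g-g\triangleleft f$, where $(f\triangleleft g)_w=\sum_{w=uvu'}f_{uu'}g_v$, the sum being over all ways of writing $w$ as a concatenation of three possibly empty words. Let $\Lambda_{\mathrm{Lie}}\colon\mathcal L(A)\to G^0$, $\Lambda_{\mathrm{Lie}}(\phi)=\sum_{w\in\mathbb N^*}\phi(w)x_w$. For every $n$, the homogeneous component of degree $n$ of $\log(\exp(X)\exp(Y))$ in the completed free associative $\mathbb K$-algebra over $X,Y$ is the image of an element $\mathrm{BCH}_n(X,Y)$ of the free Lie algebra over $X,Y$. Put $\mathrm{BCH}(f,g)=\sum_n\mathrm{BCH}_n(f,g)$ for $f,g\in G^0$, where $\mathrm{BCH}_n$ is evaluated with the bracket of $G^0$ (at each word the sum is finite). **Corollary 4.5 (BCH transport).** For $\phi,\rho\in\mathcal L(A)$ one has $\log^*(\exp^*(\phi)*\exp^*(\rho))\in\mathcal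 L(A)$, and $\mathrm{BCH}(\phi,\rho):=\log^*(\exp^*(\phi)*\exp^*(\rho))$ is a group law on $\mathcal L(A)$. Likewise $(f,g)\mapsto\mathrm{BCH}(f,g)$ is a group law on $G^0$. The map $\Lambda_{\mathrm{Lie}}$ is bijective and carries the first law to the second: $$\Lambda_{\mathrm{Lie}}\big(\mathrm{BCH}(\phi,\rho)\big)=\mathrm{BCH}\big(\Lambda_{\mathrm{Lie}}(\phi),\Lambda_{\mathrm{Lie}}(\rho)\big)\qquad(\phi,\rho\in\mathcal L(A)).$$ -/

import Mathlib

open scoped TensorProduct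

noncomputable section

namespace ShiftedBCH

universe u v

/-! ### Non-commutative formal power series and the pre-Lie product by insertion -/

/-- The module `R = A⟨⟨x₁, x₂, x₃, …⟩⟩` of formal power series in non-commuting variables indexed by
the positive integers; a series is its family of coefficients, indexed by all words, the empty word
`[]` included. -/
def NCSeries (A : Type v) : Type v := List ℕ+ → A

namespace NCSeries

variable {A : Type v} [CommRing A]

instance : AddCommGroup (NCSeries A) := inferInstanceAs (AddCommGroup (List ℕ+ → A))

instance {K : Type u} [Field K] [Algebra K A] : Module K (NCSeries A) :=
  inferInstanceAs (Module K (List ℕ+ → A))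

/-- The product `f ◁ g`. The coefficient of `f ◁ g` at `w` is the sum of `f_{u u'} g_v` over all ways
of writing `w = u v u'`. It is the bilinear (and infinitary) extension of
`x_{i₁}⋯x_{iₙ} ◁ y = ∑_{k=0}^n x_{i₁}⋯x_{i_k} y x_{i_{k+1}}⋯x_{iₙ}`, the insertion of a nonempty
word `y` at all places. -/
def preLie (f g : NCSeries A) : NCSeries A := fun w =>
  ∑ i ∈ Finset.range (w.length + 1), ∑ j ∈ Finset.range (w.length - i + 1),
    f (w.take i ++ w.drop (i + j)) * g ((w.drop i).take j)

theorem preLie_smul_left {K : Type u} [Field K] [Algebra K A] (c : K) (f g : NCSeries A) :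
    preLie (c • f) g = c • preLie f g := by
  funext w
  change preLie (c • f) g w = c • preLie f g w
  have h : ∀ v, (c • f) v = c • f v := fun _ => rfl
  simp only [preLie, h, Finset.smul_sum, smul_mul_assoc]

theorem preLie_smul_right {K : Type u} [Field K] [Algebra K A] (c : K) (f g : NCSeries A) :
    preLie f (c • g) = c • preLie f g := by
  funext w
  change preLie f (c • g) w = c • preLie f g w
  have h : ∀ v, (c • g) v = c • g v := fun _ => rfl
  simp only [preLie, h, Finset.smul_sum, mul_smul_comm]

/-- The Cauchy product of series. -/
def cauchy (f g : NCSeries A) : NCSeries A := fun w =>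
  ∑ j ∈ Finset.range (w.length + 1), f (w.take j) * g (w.drop j)

/-- The series of the coefficients at words starting with `a`. -/
def shift (a : ℕ+) (f : NCSeries A) : NCSeries A := fun w => f (a :: w)

/-- The part of `f ◁ g` where the insertion is not at the beginning of the word. -/
def inner (f g : NCSeries A) : NCSeries A
  | [] => 0
  | a :: w => preLie (shift a f) g w

theorem add_apply (f g : NCSeries A) (w) : (f + g) w = f w + g w := rfl
theorem sub_apply (f g : NCSeries A) (w) : (f - g) w = f w - g w := rfl

theorem preLie_eq (f g : NCSeries A) : preLie f g = cauchy g f + inner f g := by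
  funext w
  cases w with
  | nil => simp [preLie, cauchy, inner, add_apply, mul_comm]
  | cons a w =>
    rw [add_apply, preLie, Finset.sum_range_succ', add_comm]
    congr 1
    · simp [cauchy, mul_comm]
    · simp only [inner, preLie, shift, List.length_cons]
      refine Finset.sum_congr rfl fun i _ => ?_
      have h : w.length + 1 - (i + 1) = w.length - i := by omega
      rw [h]
      refine Finset.sum_congr rfl fun j _ => ?_
      have h' : i + 1 + j = (i + j) + 1 := by omega
      simp [h']

theorem shift_inner (a : ℕ+) (f g : NCSeries A) :
    shift a (inner f g) = preLie (shift a f) g := rfl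

theorem preLie_add_left (f f' g : NCSeries A) :
    preLie (f + f') g = preLie f g + preLie f' g := by
  funext w; simp [preLie, add_apply, add_mul, Finset.sum_add_distrib]

theorem preLie_add_right (f g g' : NCSeries A) :
    preLie f (g + g') = preLie f g + preLie f g' := by
  funext w; simp [preLie, add_apply, mul_add, Finset.sum_add_distrib]

theorem cauchy_add_left (f f' g : NCSeries A) :
    cauchy (f + f') g = cauchy f g + cauchy f' g := by
  funext w; simp [cauchy, add_apply, add_mul, Finset.sum_add_distrib]

theorem cauchy_add_right (f g g' : NCSeries A) :
    cauchy f (g + g') = cauchy f g + cauchy f g' := by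
  funext w; simp [cauchy, add_apply, mul_add, Finset.sum_add_distrib]

theorem cauchy_nil (f g : NCSeries A) : cauchy f g [] = f [] * g [] := by simp [cauchy]

theorem cauchy_cons (f g : NCSeries A) (a : ℕ+) (w : List ℕ+) :
    cauchy f g (a :: w) = f [] * g (a :: w) + cauchy (shift a f) g w := by
  simp only [cauchy, List.length_cons]
  rw [Finset.sum_range_succ', add_comm]
  simp [shift]

/-- Scaling of a series by an element of the coefficient ring. -/
def scale (c : A) (f : NCSeries A) : NCSeries A := fun w => c * f w

theorem shift_cauchy (f g : NCSeries A) (a : ℕ+) :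
    shift a (cauchy f g) = scale (f []) (shift a g) + cauchy (shift a f) g := by
  funext w; exact cauchy_cons f g a w

theorem cauchy_scale_left (c : A) (f g : NCSeries A) :
    cauchy (scale c f) g = scale c (cauchy f g) := by
  funext w; simp [cauchy, scale, Finset.mul_sum, mul_assoc]

theorem preLie_scale_left (c : A) (f g : NCSeries A) :
    preLie (scale c f) g = scale c (preLie f g) := by
  funext w; simp [preLie, scale, Finset.mul_sum, mul_assoc]

theorem cauchy_assoc_apply (w : List ℕ+) : ∀ f g h : NCSeries A,
    cauchy (cauchy f g) h w = cauchy f (cauchy g h) w := by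
  induction w with
  | nil => intro f g h; simp [cauchy_nil, mul_assoc]
  | cons a w ih =>
    intro f g h
    rw [cauchy_cons, cauchy_cons f, shift_cauchy, cauchy_add_left, add_apply, ih,
      cauchy_scale_left, cauchy_cons g, cauchy_nil]
    simp only [scale]
    ring

theorem inner_cauchy_apply (w : List ℕ+) : ∀ f g h : NCSeries A,
    inner (cauchy f g) h w = cauchy (inner f h) g w + cauchy f (inner g h) w := by
  induction w with
  | nil => intro f g h; simp [cauchy_nil, inner]
  | cons a w ih =>
    intro f g h
    rw [cauchy_cons, cauchy_cons f, shift_inner]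
    have e1 : inner (cauchy f g) h (a :: w) = preLie (shift a (cauchy f g)) h w := rfl
    have e2 : inner g h (a :: w) = preLie (shift a g) h w := rfl
    have e3 : inner f h [] = 0 := rfl
    rw [e1, e2, e3, shift_cauchy, preLie_add_left, preLie_scale_left, add_apply,
      preLie_eq (cauchy _ _), preLie_eq (shift a f), cauchy_add_left, add_apply, add_apply, ih,
      cauchy_assoc_apply]
    simp only [scale]
    ring

theorem inner_add_left (f f' g : NCSeries A) :
    inner (f + f') g = inner f g + inner f' g := by
  have h : ∀ f g : NCSeries A, inner f g = preLie f g - cauchy g f := fun f g => by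
    rw [preLie_eq]; abel
  simp only [h, preLie_add_left, cauchy_add_right]; abel

theorem preLie_assoc_apply (w : List ℕ+) : ∀ f g h : NCSeries A,
    preLie (preLie f g) h w - preLie f (preLie g h) w =
      preLie (preLie f h) g w - preLie f (preLie h g) w := by
  induction w with
  | nil => intro f g h; simp [preLie]; ring
  | cons a w ih =>
    have key : ∀ f g h : NCSeries A,
        preLie (preLie f g) h (a :: w) - preLie f (preLie g h) (a :: w) =
          cauchy h (inner f g) (a :: w) + cauchy g (inner f h) (a :: w) +
            (preLie (preLie (shift a f) g) h w - preLie (shift a f) (preLie g h) w) := by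
      intro f g h
      have e1 : inner (inner f g) h (a :: w) = preLie (preLie (shift a f) g) h w := rfl
      have e2 : inner f (preLie g h) (a :: w) = preLie (shift a f) (preLie g h) w := rfl
      rw [← e1, ← e2, preLie_eq (preLie f g), preLie_eq f g, preLie_eq f (preLie g h),
        preLie_eq g h]
      simp only [cauchy_add_left, cauchy_add_right, inner_add_left, add_apply,
        inner_cauchy_apply, cauchy_assoc_apply]
      ring
    intro f g h
    rw [key, key, ih (shift a f) g h]
    ring

end NCSeries

/-! ### The Lie algebra `(G⁰, [-,-])` -/

section

variable (K : Type u) [Field K] (A : Type v) [CommRing A] [Algebra K A]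

/-- `G⁰`: the series with zero constant coefficient. -/
def G0 : Submodule K (NCSeries A) where
  carrier := {f | f [] = 0}
  add_mem' := by
    intro f g hf hg
    change f [] = 0 at hf
    change g [] = 0 at hg
    change (f + g) [] = 0
    rw [NCSeries.add_apply, hf, hg, add_zero]
  zero_mem' := rfl
  smul_mem' := by
    intro c f hf
    change f [] = 0 at hf
    change c • f [] = 0
    rw [hf, smul_zero]

variable {K A} in
theorem G0_nil (f : G0 K A) : (f : NCSeries A) [] = 0 := f.2

/-- `G⁰` is a right pre-Lie ring for the product `◁`. The Lie bracket on `G⁰` which Mathlib derives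
from this is `[f, g] = f ◁ g - g ◁ f`. -/
instance : RightPreLieRing (G0 K A) where
  mul f g := ⟨NCSeries.preLie f.1 g.1, by
    change NCSeries.preLie f.1 g.1 [] = 0
    simp [NCSeries.preLie, G0_nil]⟩
  left_distrib f g h := Subtype.ext (NCSeries.preLie_add_right f.1 g.1 h.1)
  right_distrib f g h := Subtype.ext (NCSeries.preLie_add_left f.1 g.1 h.1)
  zero_mul f := Subtype.ext (by
    funext w
    change NCSeries.preLie 0 f.1 w = 0
    exact Finset.sum_eq_zero fun i _ => Finset.sum_eq_zero fun j _ => zero_mul _)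
  mul_zero f := Subtype.ext (by
    funext w
    change NCSeries.preLie f.1 0 w = 0
    exact Finset.sum_eq_zero fun i _ => Finset.sum_eq_zero fun j _ => mul_zero _)
  assoc_symm' f g h := Subtype.ext (by
    funext w
    exact NCSeries.preLie_assoc_apply w f.1 g.1 h.1)

instance : RightPreLieAlgebra K (G0 K A) where
  smul_assoc c f g := Subtype.ext (NCSeries.preLie_smul_left c f.1 g.1)
  smul_comm c f g := Subtype.ext (NCSeries.preLie_smul_right c f.1 g.1).symm

theorem G0_lie (f g : G0 K A) :
    ((⁅f, g⁆ : G0 K A) : NCSeries A) = NCSeries.preLie f g - NCSeries.preLie g f := rfl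

end

/-! ### The Baker-Campbell-Hausdorff series -/

section

attribute [local instance] LieRing.ofAssociativeRing

variable (K : Type u) [Field K]

/-- `exp(t a) = ∑ tⁿ aⁿ / n!`, a power series in a central variable `t` over a `K`-algebra. -/
def expSeries {B : Type v} [Ring B] [Algebra K B] (a : B) : PowerSeries B :=
  PowerSeries.mk fun n => ((n.factorial : K)⁻¹) • a ^ n

/-- The component of degree `n` of `log(exp(X) exp(Y))` in the free associative algebra over two
variables `X`, `Y`. It is the coefficient of `tⁿ` in
`log(exp(tX) exp(tY)) = ∑_{k ≥ 1} (-1)^(k-1)/k (exp(tX) exp(tY) - 1)^k`; since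
`exp(tX) exp(tY) - 1` is divisible by `t`, only the terms with `k ≤ n` contribute to it. -/
def bchAssoc (n : ℕ) : FreeAlgebra K (Fin 2) :=
  ∑ k ∈ Finset.Icc 1 n, ((-1 : K) ^ (k - 1) / (k : K)) •
    PowerSeries.coeff n
      ((expSeries K (FreeAlgebra.ι K (0 : Fin 2)) * expSeries K (FreeAlgebra.ι K (1 : Fin 2)) - 1)
        ^ k)

/-- The canonical Lie algebra map from the free Lie algebra over `X`, `Y` to the free associative
algebra over `X`, `Y` with the commutator bracket. -/
def freeLieToFree : FreeLieAlgebra K (Fin 2) →ₗ⁅K⁆ FreeAlgebra K (Fin 2) :=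
  FreeLieAlgebra.lift K (FreeAlgebra.ι K)

open Classical in
/-- The component of degree `n` of `BCH(X, Y)`: the element of the free Lie algebra over `X`, `Y`
whose image in the free associative algebra is the component of degree `n` of
`log(exp(X) exp(Y))`. (That there is one is the Baker-Campbell-Hausdorff theorem.) -/
def bchLie (n : ℕ) : FreeLieAlgebra K (Fin 2) :=
  if h : ∃ b : FreeLieAlgebra K (Fin 2), freeLieToFree K b = bchAssoc K n then h.choose else 0

/-- The BCH law `BCH(f, g)` on the Lie algebra `(G⁰, [-,-])`: the sum over `n` of the components of
`BCH(X, Y)`, evaluated at `X = f`, `Y = g` with the Lie bracket of `G⁰`. At a word of length `ℓ` only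
components of degree `n ≤ ℓ` contribute. -/
def bchG0 {A : Type v} [CommRing A] [Algebra K A] (f g : G0 K A) : G0 K A :=
  ⟨fun w => ∑ᶠ n : ℕ, ((FreeLieAlgebra.lift K ![f, g] (bchLie K n) : G0 K A) : NCSeries A) w, by
    change ∑ᶠ n : ℕ, ((FreeLieAlgebra.lift K ![f, g] (bchLie K n) : G0 K A) : NCSeries A) [] = 0
    simp only [G0_nil, finsum_zero]⟩

end

/-! ### The bialgebra `T(V)` and convolution -/

section

variable (K : Type u) [Field K] {A : Type v} [CommRing A] [Algebra K A]

/-- The vector space `V` spanned by the nonempty words in the positive integers. -/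
abbrev V : Type u := {w : List ℕ+ // w ≠ []} →₀ K

/-- The tensor algebra `T(V)`. -/
abbrev TV : Type u := TensorAlgebra K (V K)

/-- A word as an element of `T(V)`: a nonempty word as a basis vector of `V`, the empty word as the
unit `𝟏`. -/
def word : List ℕ+ → TV K
  | [] => 1
  | a :: w => TensorAlgebra.ι K (Finsupp.single ⟨a :: w, List.cons_ne_nil a w⟩ 1)

/-- The subword `w_S`. -/
def subword (w : List ℕ+) (S : Finset (Fin w.length)) : List ℕ+ :=
  ((List.finRange w.length).filter (· ∈ S)).map w.get

/-- The subwords into which `w` falls when the letters at the places in `S` are removed: the words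
`w_{J₁}, …, w_{Jₘ}` of the maximal intervals `J₁ < ⋯ < Jₘ` of the complement of `S`, in this order,
and in addition empty words, which do not affect `w_{J₁} | ⋯ | w_{Jₘ}`. -/
def gaps (w : List ℕ+) (S : Finset (Fin w.length)) : List (List ℕ+) :=
  ((List.finRange w.length).splitOnP (· ∈ S)).map (List.map w.get)

/-- The coproduct of a word, `Δ(w) = ∑_{S ⊆ [n]} w_S ⊗ w_{J₁} | ⋯ | w_{Jₘ}`. -/
def deltaWord (w : List ℕ+) : TV K ⊗[K] TV K :=
  ∑ S : Finset (Fin w.length), word K (subword w S) ⊗ₜ[K] ((gaps w S).map (word K)).prod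

/-- The coproduct `Δ` of `T(V)`, the multiplicative extension of `deltaWord`. -/
def delta : TV K →ₐ[K] TV K ⊗[K] TV K :=
  TensorAlgebra.lift K (Finsupp.linearCombination K fun w => deltaWord K w.1)

/-- The counit, with values in `A`: the unit `ε_A` of the convolution product. -/
def counit (A : Type v) [CommRing A] [Algebra K A] : TV K →ₗ[K] A :=
  (Algebra.linearMap K A).comp (TensorAlgebra.algebraMapInv (R := K) (M := V K)).toLinearMap

variable {K}

/-- The convolution product `φ * ψ = m_A ∘ (φ ⊗ ψ) ∘ Δ` on `Lin(T(V), A)`. -/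
def conv (φ ψ : TV K →ₗ[K] A) : TV K →ₗ[K] A :=
  LinearMap.mul' K A ∘ₗ TensorProduct.map φ ψ ∘ₗ (delta K).toLinearMap

/-- Convolution powers. -/
def convPow (φ : TV K →ₗ[K] A) : ℕ → (TV K →ₗ[K] A)
  | 0 => counit K A
  | n + 1 => conv φ (convPow φ n)

open Classical in
/-- The sum of a sequence of linear maps which is finite at every point (and, by convention, zero
for any other sequence). -/
def pointwiseSum (F : ℕ → (TV K →ₗ[K] A)) : TV K →ₗ[K] A :=
  if h : ∀ x, (Function.support fun n => F n x).Finite then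
    { toFun := fun x => ∑ᶠ n, F n x
      map_add' := fun x y => by
        simp only [map_add]
        exact finsum_add_distrib (h x) (h y)
      map_smul' := fun c x => by
        simp only [map_smul, RingHom.id_apply]
        exact (smul_finsum' c (h x)).symm }
  else 0

/-- `exp^*(φ) = ∑_{n ≥ 0} φ^{*n} / n!`; for `φ(𝟏) = 0` the sum is finite at every point. -/
def expConv (φ : TV K →ₗ[K] A) : TV K →ₗ[K] A :=
  pointwiseSum fun n => ((n.factorial : K)⁻¹) • convPow φ n

/-- `log^*(γ) = ∑_{n ≥ 1} (-1)^(n-1)/n (γ - ε_A)^{*n}`; for `γ(𝟏) = 1` the sum is finite at every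
point. -/
def logConv (γ : TV K →ₗ[K] A) : TV K →ₗ[K] A :=
  pointwiseSum fun n => ((-1 : K) ^ n / ((n : K) + 1)) • convPow (γ - counit K A) (n + 1)

variable (K A)

/-- The infinitesimal characters `L(A)`: the linear maps `T(V) → A` which vanish on `𝟏` and on
`V^{⊗ n}` for all `n ≥ 2`. -/
def L : Submodule K (TV K →ₗ[K] A) where
  carrier := {φ | φ 1 = 0 ∧ ∀ n ≥ 2, ∀ x ∈ LinearMap.range (TensorAlgebra.ι K (M := V K)) ^ n,
    φ x = 0}
  add_mem' := fun {φ ψ} hφ hψ => ⟨by rw [LinearMap.add_apply, hφ.1, hψ.1, add_zero],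
    fun n hn x hx => by rw [LinearMap.add_apply, hφ.2 n hn x hx, hψ.2 n hn x hx, add_zero]⟩
  zero_mem' := ⟨rfl, fun _ _ _ _ => rfl⟩
  smul_mem' := fun c φ hφ => ⟨by rw [LinearMap.smul_apply, hφ.1, smul_zero],
    fun n hn x hx => by rw [LinearMap.smul_apply, hφ.2 n hn x hx, smul_zero]⟩

/-- `Λ(φ) = φ(𝟏) + ∑_w φ(w) x_w`, on `Lin(T(V), A)`. -/
def Lambda : (TV K →ₗ[K] A) →ₗ[K] NCSeries A where
  toFun φ := fun w => φ (word K w)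
  map_add' _ _ := rfl
  map_smul' _ _ := rfl

/-- `Λ_Lie : L(A) → G⁰`, the restriction of `Λ`. -/
def LambdaLie : L K A →ₗ[K] G0 K A :=
  (Lambda K A).restrict (p := L K A) (q := G0 K A) fun _ hφ => hφ.1

end

/-- `op` is a group law on the set `X`. -/
structure IsGroupLaw {X : Type v} (op : X → X → X) : Prop where
  assoc : ∀ a b c, op (op a b) c = op a (op b c)
  exists_unit_inv : ∃ e, (∀ a, op e a = a ∧ op a e = a) ∧ ∀ a, ∃ b, op b a = e ∧ op a b = e

end ShiftedBCH

end

/-! On `L(A)` the law is multiplication of the convolution algebra read through the exponential: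
`exp^*` is injective, `log^*` undoes it, and `exp^*(BCH(φ, ρ)) = exp^*(φ) * exp^*(ρ)`. The group
axioms are thus inherited, with unit `0` and inverse `-φ`. What needs proof is that `log^*` lands in
`L(A)` again and that the law depends on the bracket alone.

Both come from the Baker-Campbell-Hausdorff theorem. In the free algebra `exp(tX) exp(tY)` is
group-like, so the components of its logarithm are primitive (`shuffleDelta_bchAssoc`). The Dynkin
operator, the convolution of the antipode with the degree derivation, takes values in Lie elements
(`dynkinTensor_shuffleDelta`) and multiplies a primitive element of degree `n` by `n`; in
characteristic zero the components are therefore Lie elements. Evaluated in a filtered algebra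
(`IsLog.sumsTo_bchAssoc`), this writes `log^*(exp^*(φ) * exp^*(ρ))` as a sum of Lie polynomials in
`φ`, `ρ`, and `L(A)` is closed under commutators (`conv_sub_conv_mem_L`) and under such sums.

The link with `G⁰`: in `Δ(w)` an infinitesimal character on the right only sees those `S` whose
complement is one interval, so `φ * ψ` at `w` is a sum over `w = u v u'`, that is, `Λ(φ * ψ) = Λ(φ)
◁ Λ(ψ)` (`Lambda_conv`). Hence `Λ_Lie` is an isomorphism of Lie algebras, commutes with every
`BCH_n`, and transports the group law. Any preimage chosen by `bchLie` serves, as only its image in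
the free associative algebra matters; injectivity of `freeLieToFree` plays no role. -/

noncomputable section

namespace ShiftedBCH

/-! ### Truncated exponential and logarithm polynomials -/

section Truncated

open Polynomial Finset

variable (K : Type*) [Field K]

/-- The coefficients of `log(1 + X)`. -/
def logCoeff (n : ℕ) : K := (-1) ^ (n - 1) / (n : K)

/-- The exponential series, truncated at degree `N`. -/
def expPoly (N : ℕ) : K[X] := ∑ n ∈ range N, C ((n.factorial : K)⁻¹) * X ^ n

/-- The series `log(1 + X)`, truncated at degree `N`. -/
def logPoly (N : ℕ) : K[X] := ∑ n ∈ range N, C (logCoeff K n) * X ^ n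

/-- Division by zero gives `0`, so the logarithm series can be indexed from `0`. -/
theorem logCoeff_zero : logCoeff K 0 = 0 := by simp [logCoeff]

theorem logCoeff_succ (n : ℕ) : logCoeff K (n + 1) = (-1) ^ n / ((n : K) + 1) := by
  simp [logCoeff]

theorem X_dvd_logPoly (N : ℕ) : (X : K[X]) ∣ logPoly K N := by
  refine Finset.dvd_sum fun n _ => ?_
  cases n with
  | zero => simp [logCoeff_zero]
  | succ n => exact Dvd.dvd.mul_left (dvd_pow_self _ (Nat.succ_ne_zero n)) _

theorem X_dvd_expPoly_sub_one (N : ℕ) : (X : K[X]) ∣ expPoly K (N + 1) - 1 := by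
  rw [expPoly, Finset.sum_range_succ']
  simp only [Nat.factorial_zero, Nat.cast_one, inv_one, map_one, pow_zero, mul_one,
    add_sub_cancel_right]
  exact Finset.dvd_sum fun n _ => Dvd.dvd.mul_left (dvd_pow_self _ (Nat.succ_ne_zero n)) _

-- In characteristic zero the coefficients of positive degree can be recovered from the derivative.
variable {K} in
theorem X_pow_succ_dvd_of_derivative [CharZero K] {p : K[X]} {n : ℕ} (h0 : X ∣ p)
    (h : X ^ n ∣ derivative p) : X ^ (n + 1) ∣ p := by
  rw [X_dvd_iff] at h0
  rw [X_pow_dvd_iff] at h ⊢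
  intro d hd
  cases d with
  | zero => exact h0
  | succ d =>
    have := h d (by omega)
    rw [coeff_derivative] at this
    have h1 : (d : K) + 1 ≠ 0 := Nat.cast_add_one_ne_zero d
    exact (mul_eq_zero.mp this).resolve_right h1

theorem derivative_expPoly [CharZero K] (N : ℕ) :
    derivative (expPoly K (N + 1)) = expPoly K N := by
  rw [expPoly, Finset.sum_range_succ']
  simp only [derivative_add, derivative_sum, derivative_C_mul_X_pow, pow_zero, mul_one,
    derivative_C, add_zero, expPoly]
  refine Finset.sum_congr rfl fun n _ => ?_
  have h1 : (n : K) + 1 ≠ 0 := Nat.cast_add_one_ne_zero n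
  have h2 : (n.factorial : K) ≠ 0 := Nat.cast_ne_zero.mpr n.factorial_ne_zero
  rw [Nat.factorial_succ, Nat.add_sub_cancel]
  congr 2
  push_cast
  field_simp

theorem expPoly_succ (N : ℕ) :
    expPoly K (N + 1) = expPoly K N + C ((N.factorial : K)⁻¹) * X ^ N :=
  Finset.sum_range_succ _ _

/-- The derivative of the truncated logarithm is a finite geometric sum in `-X`. -/
theorem one_add_X_mul_derivative_logPoly [CharZero K] (N : ℕ) :
    (1 + X) * derivative (logPoly K (N + 1)) = 1 - (-X) ^ N := by
  have : derivative (logPoly K (N + 1)) = ∑ n ∈ range N, (-X : K[X]) ^ n := by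
    rw [logPoly, Finset.sum_range_succ']
    simp only [derivative_add, derivative_sum, derivative_C_mul_X_pow, pow_zero, mul_one,
      derivative_C, add_zero]
    refine Finset.sum_congr rfl fun n _ => ?_
    have h1 : (n : K) + 1 ≠ 0 := Nat.cast_add_one_ne_zero n
    rw [logCoeff_succ, Nat.add_sub_cancel]
    push_cast
    rw [div_mul_cancel₀ _ h1, neg_pow (X : K[X])]
    simp
  rw [this, ← mul_neg_geom_sum]
  ring

/-- The constant term vanishes and the derivative consists of truncation errors. A polynomial
congruence, unlike an identity of series, can be evaluated at any element of an algebra. -/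
theorem X_pow_dvd_X_sub_log_exp [CharZero K] (N : ℕ) :
    (X : K[X]) ^ N ∣ X - (logPoly K N).comp (expPoly K N - 1) := by
  cases N with
  | zero => simp
  | succ M =>
    have hE := X_dvd_expPoly_sub_one K M
    refine X_pow_succ_dvd_of_derivative (dvd_sub dvd_rfl ?_) ?_
    · obtain ⟨q, hq⟩ := X_dvd_logPoly K (M + 1)
      rw [hq, mul_comp, X_comp]
      exact hE.mul_right _
    · have h1 := congrArg (fun p => p.comp (expPoly K (M + 1) - 1))
        (one_add_X_mul_derivative_logPoly K M)
      simp only [mul_comp, add_comp, one_comp, X_comp, sub_comp, pow_comp, neg_comp] at h1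
      rw [derivative_sub, derivative_X, derivative_comp, derivative_sub, derivative_one,
        derivative_expPoly, sub_zero]
      have h2 := expPoly_succ K M
      have h3 : (X : K[X]) ^ M ∣ (-(expPoly K (M + 1) - 1)) ^ M := pow_dvd_pow_of_dvd
        ((dvd_neg).mpr hE) M
      -- The first error is the tail of the geometric sum, the second the top term which `expPoly`
      -- loses on differentiation.
      have : 1 - expPoly K M * (derivative (logPoly K (M + 1))).comp (expPoly K (M + 1) - 1) =
          (-(expPoly K (M + 1) - 1)) ^ M + X ^ M * (C ((M.factorial : K)⁻¹) *
            (derivative (logPoly K (M + 1))).comp (expPoly K (M + 1) - 1)) := by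
        have h4 : expPoly K M = expPoly K (M + 1) - C ((M.factorial : K)⁻¹) * X ^ M := by
          rw [h2]; ring
        rw [h4]
        linear_combination -h1
      rw [this]
      exact dvd_add h3 (dvd_mul_right _ _)

/-- The defect `D` has zero constant term and satisfies `(1 + X) D' = D` modulo `X ^ M`, which
raises its order of vanishing step by step. -/
theorem X_pow_dvd_one_add_X_sub_exp_log [CharZero K] (N : ℕ) :
    (X : K[X]) ^ N ∣ 1 + X - (expPoly K N).comp (logPoly K N) := by
  cases N with
  | zero => simp
  | succ M =>
    set D := 1 + X - (expPoly K (M + 1)).comp (logPoly K (M + 1)) with hD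
    have hL := X_dvd_logPoly K (M + 1)
    have h0 : X ∣ D := by
      obtain ⟨q, hq⟩ := X_dvd_expPoly_sub_one K M
      have : expPoly K (M + 1) = 1 + X * q := by rw [← hq]; ring
      rw [hD, this, add_comp, one_comp, mul_comp, X_comp]
      have : (1 : K[X]) + X - (1 + logPoly K (M + 1) * q.comp (logPoly K (M + 1))) =
        X - logPoly K (M + 1) * q.comp (logPoly K (M + 1)) := by ring
      rw [this]
      exact dvd_sub dvd_rfl (hL.mul_right _)
    have hode : X ^ M ∣ (1 + X) * derivative D - D := by
      have h1 := one_add_X_mul_derivative_logPoly K M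
      have h2 := congrArg (fun p => p.comp (logPoly K (M + 1))) (expPoly_succ K M)
      simp only [add_comp, mul_comp, C_comp, pow_comp, X_comp] at h2
      have h3 : derivative D =
          1 - derivative (logPoly K (M + 1)) * (expPoly K M).comp (logPoly K (M + 1)) := by
        rw [hD, derivative_sub, derivative_add, derivative_one, derivative_X, zero_add,
          derivative_comp, derivative_expPoly]
      have h4 : (1 + X) * derivative D - D = (-X) ^ M * (expPoly K M).comp (logPoly K (M + 1)) +
          C ((M.factorial : K)⁻¹) * logPoly K (M + 1) ^ M := by
        rw [h3, hD, h2]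
        linear_combination (-(expPoly K M).comp (logPoly K (M + 1))) * h1
      rw [h4]
      exact dvd_add ((pow_dvd_pow_of_dvd (dvd_neg.mpr dvd_rfl) M).mul_right _)
        ((pow_dvd_pow_of_dvd hL M).mul_left _)
    have key : ∀ k ≤ M, X ^ (k + 1) ∣ D := by
      intro k
      induction k with
      | zero => intro _; simpa using h0
      | succ k ih =>
        intro hk
        have h5 := ih (by omega)
        refine X_pow_succ_dvd_of_derivative h0 ?_
        have h6 : X ^ (k + 1) ∣ (1 + X) * derivative D := by
          have := dvd_add ((pow_dvd_pow _ hk).trans hode) h5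
          simpa using this
        -- `1 + X` is coprime to `X`, so the divisibility passes to the derivative of `D`.
        refine IsCoprime.dvd_of_dvd_mul_left (IsCoprime.pow_left ?_) h6
        exact ⟨-1, 1, by ring⟩
    exact key M le_rfl

end Truncated

/-! ### Filtered algebras, and sums, exponentials and logarithms in them -/

section Filtered

open Finset

variable {K : Type*} [Field K] {R : Type*} [Ring R] [Algebra K R]

/-- A separated multiplicative filtration of an algebra by two-sided ideals. -/
structure IsFiltration (I : ℕ → Submodule K R) : Prop where
  zero_eq_top : I 0 = ⊤
  antitone : Antitone I
  mul_mem : ∀ {m n : ℕ} {a b : R}, a ∈ I m → b ∈ I n → a * b ∈ I (m + n)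
  eq_zero : ∀ {a : R}, (∀ n, a ∈ I n) → a = 0

/-- `s` is the sum of the series `∑ u n`, the `N`-th remainder lying in `I N`. -/
def SumsTo (I : ℕ → Submodule K R) (u : ℕ → R) (s : R) : Prop :=
  ∀ N, s - ∑ n ∈ range N, u n ∈ I N

/-- `e = exp(x)`. -/
def IsExp (I : ℕ → Submodule K R) (x e : R) : Prop :=
  SumsTo I (fun n => ((n.factorial : K)⁻¹) • x ^ n) e

/-- `s = log(1 + y)`. -/
def IsLog (I : ℕ → Submodule K R) (y s : R) : Prop :=
  SumsTo I (fun n => logCoeff K n • y ^ n) s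

variable {I : ℕ → Submodule K R}

theorem IsFiltration.mem_zero (hI : IsFiltration I) (a : R) : a ∈ I 0 := by
  rw [hI.zero_eq_top]; trivial

theorem IsFiltration.mul_mem_left (hI : IsFiltration I) {n : ℕ} {b : R} (a : R) (hb : b ∈ I n) :
    a * b ∈ I n := by
  simpa using hI.mul_mem (hI.mem_zero a) hb

theorem IsFiltration.mul_mem_right (hI : IsFiltration I) {n : ℕ} {a : R} (b : R) (ha : a ∈ I n) :
    a * b ∈ I n := by
  simpa using hI.mul_mem ha (hI.mem_zero b)

theorem IsFiltration.pow_mem (hI : IsFiltration I) {x : R} (hx : x ∈ I 1) (n : ℕ) :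
    x ^ n ∈ I n := by
  induction n with
  | zero => exact hI.mem_zero _
  | succ n ih => rw [pow_succ]; exact hI.mul_mem ih hx

theorem IsFiltration.mul_sub_mul_mem (hI : IsFiltration I) {n : ℕ} {a a' b b' : R}
    (ha : a - a' ∈ I n) (hb : b - b' ∈ I n) : a * b - a' * b' ∈ I n := by
  have : a * b - a' * b' = (a - a') * b + a' * (b - b') := by noncomm_ring
  rw [this]
  exact add_mem (hI.mul_mem_right _ ha) (hI.mul_mem_left _ hb)

theorem IsFiltration.pow_sub_pow_mem (hI : IsFiltration I) {n : ℕ} {a b : R}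
    (h : a - b ∈ I n) (k : ℕ) : a ^ k - b ^ k ∈ I n := by
  induction k with
  | zero => simp
  | succ k ih => rw [pow_succ, pow_succ]; exact hI.mul_sub_mul_mem ih h

theorem SumsTo.unique (hI : IsFiltration I) {u : ℕ → R} {s t : R} (hs : SumsTo I u s)
    (ht : SumsTo I u t) : s = t := by
  refine sub_eq_zero.mp (hI.eq_zero fun n => ?_)
  have := sub_mem (hs n) (ht n)
  rwa [sub_sub_sub_cancel_right] at this

theorem SumsTo.sub {u v : ℕ → R} {s t : R} (hs : SumsTo I u s) (ht : SumsTo I v t) :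
    SumsTo I (fun n => u n - v n) (s - t) := fun N => by
  rw [Finset.sum_sub_distrib, sub_sub_sub_comm]
  exact sub_mem (hs N) (ht N)

theorem SumsTo.congr {u v : ℕ → R} {s : R} (hs : SumsTo I u s) (h : ∀ n, u n = v n) :
    SumsTo I v s := by
  rwa [← show u = v from funext h]

theorem SumsTo.map {R' : Type*} [Ring R'] [Algebra K R'] {J : ℕ → Submodule K R'}
    (f : R →ₗ[K] R') (hf : ∀ n a, a ∈ I n → f a ∈ J n) {u : ℕ → R} {s : R} (hs : SumsTo I u s) :
    SumsTo J (fun n => f (u n)) (f s) := fun N => by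
  rw [← map_sum, ← map_sub]
  exact hf _ _ (hs N)

theorem IsExp.map {R' : Type*} [Ring R'] [Algebra K R'] {J : ℕ → Submodule K R'}
    (f : R →ₐ[K] R') (hf : ∀ n a, a ∈ I n → f a ∈ J n) {x e : R} (h : IsExp I x e) :
    IsExp J (f x) (f e) :=
  (SumsTo.map f.toLinearMap hf h).congr fun n => by simp

/-- The square of index pairs is cut along `i + j = N`: below lies the partial sum of the Cauchy
product, above the error in `SumsTo.mul`. -/
theorem sum_range_mul_sum_range (u v : ℕ → R) (N : ℕ) :
    (∑ i ∈ range N, u i) * (∑ j ∈ range N, v j) =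
      (∑ n ∈ range N, ∑ p ∈ antidiagonal n, u p.1 * v p.2) +
        ∑ p ∈ (range N ×ˢ range N) with ¬ p.1 + p.2 < N, u p.1 * v p.2 := by
  rw [Finset.sum_mul_sum, ← Finset.sum_product',
    ← Finset.sum_filter_add_sum_filter_not _ (fun p : ℕ × ℕ => p.1 + p.2 < N)]
  congr 1
  rw [← Finset.sum_fiberwise_of_maps_to (g := fun p : ℕ × ℕ => p.1 + p.2) (t := range N)
    (fun p hp => by simpa using (Finset.mem_filter.mp hp).2)]
  refine Finset.sum_congr rfl fun n hn => Finset.sum_congr ?_ fun _ _ => rfl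
  ext p
  simp only [mem_filter, mem_product, mem_range, HasAntidiagonal.mem_antidiagonal] at *
  omega

theorem SumsTo.mul (hI : IsFiltration I) {u v : ℕ → R} {s t : R} (hu : ∀ n, u n ∈ I n)
    (hv : ∀ n, v n ∈ I n) (hs : SumsTo I u s) (ht : SumsTo I v t) :
    SumsTo I (fun n => ∑ p ∈ antidiagonal n, u p.1 * v p.2) (s * t) := fun N => by
  have h := hI.mul_sub_mul_mem (hs N) (ht N)
  rw [sum_range_mul_sum_range, ← sub_sub] at h
  have h' : ∑ p ∈ (range N ×ˢ range N) with ¬ p.1 + p.2 < N, u p.1 * v p.2 ∈ I N := by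
    refine Submodule.sum_mem _ fun p hp => ?_
    have := (Finset.mem_filter.mp hp).2
    exact hI.antitone (not_lt.mp this) (hI.mul_mem (hu _) (hv _))
  simpa using add_mem h h'

/-- By the binomial formula for commuting elements, the Cauchy product of the two exponential series
is the exponential series of the sum, term by term. -/
theorem IsExp.add_of_commute [CharZero K] (hI : IsFiltration I) {a b e f : R} (hab : Commute a b)
    (ha : a ∈ I 1) (hb : b ∈ I 1) (he : IsExp I a e) (hf : IsExp I b f) :
    IsExp I (a + b) (e * f) := by
  refine (SumsTo.mul hI (fun n => Submodule.smul_mem _ _ (hI.pow_mem ha n))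
    (fun n => Submodule.smul_mem _ _ (hI.pow_mem hb n)) he hf).congr fun n => ?_
  rw [hab.add_pow', Finset.smul_sum]
  refine Finset.sum_congr rfl fun p hp => ?_
  rw [HasAntidiagonal.mem_antidiagonal] at hp
  rw [smul_mul_smul_comm, ← Nat.cast_smul_eq_nsmul K, smul_smul, ← hp,
    ← Nat.add_choose_mul_factorial_mul_factorial p.1 p.2, ← Nat.choose_symm_add]
  congr 1
  have h1 : (p.1.factorial : K) ≠ 0 := Nat.cast_ne_zero.mpr p.1.factorial_ne_zero
  have h2 : (p.2.factorial : K) ≠ 0 := Nat.cast_ne_zero.mpr p.2.factorial_ne_zero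
  have h3 : ((p.1 + p.2).choose p.1 : K) ≠ 0 :=
    Nat.cast_ne_zero.mpr (Nat.choose_pos (Nat.le_add_right _ _)).ne'
  push_cast
  field_simp

theorem isExp_zero (hI : IsFiltration I) : IsExp I (0 : R) 1 := fun N => by
  cases N with
  | zero => exact hI.mem_zero _
  | succ N => rw [Finset.sum_range_succ']; simp

theorem IsFiltration.aeval_mem (hI : IsFiltration I) {x : R} (hx : x ∈ I 1) {N : ℕ}
    {p : Polynomial K} (h : Polynomial.X ^ N ∣ p) : Polynomial.aeval x p ∈ I N := by
  obtain ⟨q, rfl⟩ := h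
  rw [map_mul, map_pow, Polynomial.aeval_X]
  exact hI.mul_mem_right _ (hI.pow_mem hx N)

theorem aeval_expPoly (x : R) (N : ℕ) :
    Polynomial.aeval x (expPoly K N) = ∑ n ∈ range N, ((n.factorial : K)⁻¹) • x ^ n := by
  simp [expPoly, map_sum, Algebra.smul_def]

theorem aeval_logPoly (x : R) (N : ℕ) :
    Polynomial.aeval x (logPoly K N) = ∑ n ∈ range N, logCoeff K n • x ^ n := by
  simp [logPoly, map_sum, Algebra.smul_def]

theorem IsFiltration.sum_smul_pow_sub_mem (hI : IsFiltration I) {N : ℕ} {a b : R}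
    (h : a - b ∈ I N) (c : ℕ → K) (M : ℕ) :
    ∑ n ∈ range M, c n • a ^ n - ∑ n ∈ range M, c n • b ^ n ∈ I N := by
  rw [← Finset.sum_sub_distrib]
  refine Submodule.sum_mem _ fun n _ => ?_
  rw [← smul_sub]
  exact Submodule.smul_mem _ _ (hI.pow_sub_pow_mem h n)

/-- Modulo `I N`, `e` is the truncated exponential of `x`, so this is `X_pow_dvd_X_sub_log_exp`
evaluated at `x`; no completeness is needed. -/
theorem IsExp.isLog [CharZero K] (hI : IsFiltration I) {x e : R} (hx : x ∈ I 1)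
    (he : IsExp I x e) : IsLog I (e - 1) x := fun N => by
  have h1 : (e - 1) - Polynomial.aeval x (expPoly K N - 1) ∈ I N := by
    rw [map_sub, map_one, sub_sub_sub_cancel_right, aeval_expPoly]
    exact he N
  have h2 := hI.aeval_mem hx (X_pow_dvd_X_sub_log_exp K N)
  rw [map_sub, Polynomial.aeval_X, Polynomial.aeval_comp, aeval_logPoly] at h2
  have h3 := hI.sum_smul_pow_sub_mem h1 (logCoeff K) N
  simpa using sub_mem h2 h3

theorem IsLog.isExp [CharZero K] (hI : IsFiltration I) {y x : R} (hy : y ∈ I 1)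
    (hx : IsLog I y x) : IsExp I x (1 + y) := fun N => by
  have h1 : x - Polynomial.aeval y (logPoly K N) ∈ I N := by
    rw [aeval_logPoly]
    exact hx N
  have h2 := hI.aeval_mem hy (X_pow_dvd_one_add_X_sub_exp_log K N)
  rw [map_sub, map_add, map_one, Polynomial.aeval_X, Polynomial.aeval_comp, aeval_expPoly] at h2
  have h3 := hI.sum_smul_pow_sub_mem h1 (fun n => (n.factorial : K)⁻¹) N
  simpa using sub_mem h2 h3

theorem SumsTo.mem_one {u : ℕ → R} {s : R} (hs : SumsTo I u s)
    (h0 : u 0 ∈ I 1) : s ∈ I 1 := by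
  have := add_mem (hs 1) h0
  simpa using this

theorem IsLog.mem_one {y s : R} (hs : IsLog I y s) : s ∈ I 1 :=
  SumsTo.mem_one hs (by simp [logCoeff_zero])

theorem IsExp.sub_one_mem {x e : R} (he : IsExp I x e) : e - 1 ∈ I 1 := by
  simpa using he 1

end Filtered

/-! ### Power series over a non-commutative algebra -/

section PowerSeriesFiltration

open Finset

variable (K : Type*) [Field K] (R : Type*) [Ring R] [Algebra K R]

/-- The filtration of `R⟦t⟧` by the powers of `t`. -/
def tFiltration (n : ℕ) : Submodule K (PowerSeries R) where
  carrier := {f | ∀ k < n, PowerSeries.coeff k f = 0}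
  add_mem' hf hg k hk := by rw [map_add, hf k hk, hg k hk, add_zero]
  zero_mem' _ _ := map_zero _
  smul_mem' c f hf k hk := by
    change c • PowerSeries.coeff k f = 0
    rw [hf k hk, smul_zero]

variable {K R}

variable (K R) in
theorem tFiltration_isFiltration : IsFiltration (tFiltration K R) where
  zero_eq_top := by
    rw [eq_top_iff]
    intro f _ k hk
    exact absurd hk (Nat.not_lt_zero k)
  antitone m n hmn f hf k hk := hf k (hk.trans_le hmn)
  mul_mem {m n a b} ha hb k hk := by
    rw [PowerSeries.coeff_mul]
    refine Finset.sum_eq_zero fun p hp => ?_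
    rw [HasAntidiagonal.mem_antidiagonal] at hp
    by_cases h : p.1 < m
    · rw [ha _ h, zero_mul]
    · rw [hb p.2 (by omega), mul_zero]
  eq_zero {a} h := by
    ext k
    exact h (k + 1) k (Nat.lt_succ_self k)

theorem sumsTo_tFiltration {u : ℕ → PowerSeries R} {s : PowerSeries R}
    (h : ∀ N, ∀ k < N, PowerSeries.coeff k s = ∑ n ∈ range N, PowerSeries.coeff k (u n)) :
    SumsTo (tFiltration K R) u s := fun N k hk => by
  rw [map_sub, map_sum, h N k hk, sub_self]

theorem monomial_one_pow (a : R) (n : ℕ) :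
    (PowerSeries.monomial 1 a) ^ n = PowerSeries.monomial n (a ^ n) := by
  induction n with
  | zero => simp
  | succ n ih => rw [pow_succ, ih, PowerSeries.monomial_mul_monomial, pow_succ]

theorem monomial_one_mem (a : R) : PowerSeries.monomial 1 a ∈ tFiltration K R 1 := fun k hk => by
  rw [PowerSeries.coeff_monomial, if_neg (by omega)]

theorem coeff_smul_ps (c : K) (f : PowerSeries R) (k : ℕ) :
    PowerSeries.coeff k (c • f) = c • PowerSeries.coeff k f := rfl

theorem isExp_expSeries (a : R) :
    IsExp (tFiltration K R) (PowerSeries.monomial 1 a) (expSeries K a) :=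
  sumsTo_tFiltration fun N k hk => by
    simp only [coeff_smul_ps, monomial_one_pow, PowerSeries.coeff_monomial, expSeries,
      PowerSeries.coeff_mk, smul_ite, smul_zero]
    rw [Finset.sum_ite_eq, if_pos (Finset.mem_range.mpr hk)]

theorem expSeries_add_of_commute [CharZero K] {a b : R} (h : Commute a b) :
    expSeries K (a + b) = expSeries K a * expSeries K b := by
  have hI := tFiltration_isFiltration K R
  refine SumsTo.unique hI (isExp_expSeries (a + b)) ?_
  rw [map_add]
  refine IsExp.add_of_commute hI ?_ (monomial_one_mem a) (monomial_one_mem b)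
    (isExp_expSeries a) (isExp_expSeries b)
  rw [commute_iff_eq, PowerSeries.monomial_mul_monomial, PowerSeries.monomial_mul_monomial, h.eq]

variable {R' : Type*} [Ring R'] [Algebra K R']

/-- An algebra morphism, applied to the coefficients of a power series. -/
def psMap (f : R →ₐ[K] R') : PowerSeries R →ₐ[K] PowerSeries R' :=
  { PowerSeries.map (f : R →+* R') with
    commutes' := fun c => by
      ext k
      simp only [Algebra.algebraMap_eq_smul_one]
      change f (PowerSeries.coeff k (c • (1 : PowerSeries R))) = _
      rw [coeff_smul_ps, coeff_smul_ps, map_smul, PowerSeries.coeff_one, PowerSeries.coeff_one]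
      split_ifs <;> simp }

theorem coeff_psMap (f : R →ₐ[K] R') (g : PowerSeries R) (k : ℕ) :
    PowerSeries.coeff k (psMap f g) = f (PowerSeries.coeff k g) := rfl

theorem psMap_mem (f : R →ₐ[K] R') (n : ℕ) (a : PowerSeries R) (ha : a ∈ tFiltration K R n) :
    psMap f a ∈ tFiltration K R' n := fun k hk => by
  rw [coeff_psMap, ha k hk, map_zero]

theorem psMap_expSeries (f : R →ₐ[K] R') (a : R) :
    psMap f (expSeries K a) = expSeries K (f a) := by
  ext k
  rw [coeff_psMap]
  simp [expSeries]

theorem commute_of_coeff {f g : PowerSeries R}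
    (h : ∀ i j, Commute (PowerSeries.coeff i f) (PowerSeries.coeff j g)) : Commute f g := by
  rw [commute_iff_eq]
  ext k
  rw [PowerSeries.coeff_mul, PowerSeries.coeff_mul, ← Finset.Nat.sum_antidiagonal_swap]
  exact Finset.sum_congr rfl fun p _ => (h _ _).eq

end PowerSeriesFiltration

/-! ### The Baker-Campbell-Hausdorff theorem -/

section BCH

open Finset

variable (K : Type*) [Field K]

/-- The free associative algebra over `X`, `Y`. -/
abbrev FreeXY : Type _ := FreeAlgebra K (Fin 2)

/-- The series `exp(tX) exp(tY)`. -/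
def expXY : PowerSeries (FreeXY K) :=
  expSeries K (FreeAlgebra.ι K (0 : Fin 2)) * expSeries K (FreeAlgebra.ι K (1 : Fin 2))

/-- The series `log(exp(tX) exp(tY))`. -/
def bchSeries : PowerSeries (FreeXY K) := PowerSeries.mk (bchAssoc K)

theorem expXY_sub_one_mem [CharZero K] : expXY K - 1 ∈ tFiltration K (FreeXY K) 1 := by
  have h := (tFiltration_isFiltration K (FreeXY K)).mul_sub_mul_mem
    (isExp_expSeries (K := K) (FreeAlgebra.ι K (0 : Fin 2))).sub_one_mem
    (isExp_expSeries (K := K) (FreeAlgebra.ι K (1 : Fin 2))).sub_one_mem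
  rwa [mul_one] at h

theorem coeff_expXY_sub_one_pow [CharZero K] {k n : ℕ} (h : k < n) :
    PowerSeries.coeff k ((expXY K - 1) ^ n) = 0 :=
  (tFiltration_isFiltration K (FreeXY K)).pow_mem (expXY_sub_one_mem K) n k h

/-- The added powers are divisible by too high a power of `t` to contribute, so one range serves for
all coefficients below `t ^ N`. -/
theorem bchAssoc_eq_sum_range [CharZero K] {k N : ℕ} (h : k < N) :
    bchAssoc K k =
      ∑ n ∈ range N, logCoeff K n • PowerSeries.coeff k ((expXY K - 1) ^ n) := by
  refine Finset.sum_subset (fun n hn => ?_) fun n hn hn' => ?_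
  · rw [Finset.mem_Icc] at hn
    exact Finset.mem_range.mpr (by omega)
  · rw [Finset.mem_Icc] at hn'
    by_cases h0 : n = 0
    -- The coefficient is a quotient by zero, hence `0`.
    · simp [h0]
    · have := coeff_expXY_sub_one_pow K (show k < n by omega)
      rw [expXY] at this
      rw [this, smul_zero]

theorem isLog_bchSeries [CharZero K] :
    IsLog (tFiltration K (FreeXY K)) (expXY K - 1) (bchSeries K) :=
  sumsTo_tFiltration fun N k hk => by
    rw [bchSeries, PowerSeries.coeff_mk, bchAssoc_eq_sum_range K hk]
    rfl

/-! ### Primitivity of the components of the BCH series -/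

/-- The coproduct of the free algebra for which the variables are primitive. -/
def shuffleDelta : FreeXY K →ₐ[K] FreeXY K ⊗[K] FreeXY K :=
  FreeAlgebra.lift K fun i => FreeAlgebra.ι K i ⊗ₜ 1 + 1 ⊗ₜ FreeAlgebra.ι K i

theorem shuffleDelta_ι (i : Fin 2) : shuffleDelta K (FreeAlgebra.ι K i) =
    FreeAlgebra.ι K i ⊗ₜ 1 + 1 ⊗ₜ FreeAlgebra.ι K i :=
  FreeAlgebra.lift_ι_apply _ _

theorem commute_left_right (a b : FreeXY K) :
    Commute (a ⊗ₜ[K] (1 : FreeXY K)) ((1 : FreeXY K) ⊗ₜ[K] b) := by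
  rw [commute_iff_eq]
  simp

/-- `exp(tX)` and `exp(tY)` are group-like, hence so is their product `E`: the coproduct sends it to
`l(E) r(E)`, where the images of `l` and `r` commute. So `l(E) r(E)` is the exponential of `l(log E)
+ r(log E)`, and uniqueness of the logarithm gives the claim coefficientwise. -/
theorem shuffleDelta_bchAssoc [CharZero K] (n : ℕ) :
    shuffleDelta K (bchAssoc K n) = bchAssoc K n ⊗ₜ 1 + 1 ⊗ₜ bchAssoc K n := by
  have hI := tFiltration_isFiltration K (FreeXY K)
  have hJ := tFiltration_isFiltration K (FreeXY K ⊗[K] FreeXY K)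
  let l : FreeXY K →ₐ[K] FreeXY K ⊗[K] FreeXY K := Algebra.TensorProduct.includeLeft
  let r : FreeXY K →ₐ[K] FreeXY K ⊗[K] FreeXY K := Algebra.TensorProduct.includeRight
  have hlr : ∀ f g, Commute (psMap l f) (psMap r g) := fun f g =>
    commute_of_coeff fun i j => commute_left_right K _ _
  have hl : bchSeries K ∈ tFiltration K (FreeXY K) 1 := (isLog_bchSeries K).mem_one
  have he : IsExp (tFiltration K (FreeXY K)) (bchSeries K) (expXY K) := by
    have := (isLog_bchSeries K).isExp hI (expXY_sub_one_mem K)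
    rwa [add_sub_cancel] at this
  have hexp : ∀ i : Fin 2, psMap (shuffleDelta K) (expSeries K (FreeAlgebra.ι K i)) =
      psMap l (expSeries K (FreeAlgebra.ι K i)) * psMap r (expSeries K (FreeAlgebra.ι K i)) := by
    intro i
    rw [psMap_expSeries, psMap_expSeries, psMap_expSeries, shuffleDelta_ι,
      expSeries_add_of_commute (commute_left_right K _ _)]
    rfl
  have hE : psMap (shuffleDelta K) (expXY K) = psMap l (expXY K) * psMap r (expXY K) := by
    rw [expXY, map_mul, map_mul, map_mul, hexp, hexp]
    simp only [mul_assoc]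
    congr 1
    rw [← mul_assoc, ← mul_assoc, (hlr _ _).eq]
  have h1 : IsExp _ _ _ := he.map (psMap (shuffleDelta K)) (psMap_mem _)
  have h2 := IsExp.add_of_commute hJ (hlr _ _) (psMap_mem l 1 _ hl) (psMap_mem r 1 _ hl)
    (he.map (psMap l) (psMap_mem l)) (he.map (psMap r) (psMap_mem r))
  rw [← hE] at h2
  have h3 := SumsTo.unique hJ (h1.isLog hJ (psMap_mem _ 1 _ hl))
    (h2.isLog hJ (add_mem (psMap_mem l 1 _ hl) (psMap_mem r 1 _ hl)))
  have h4 := congrArg (PowerSeries.coeff n) h3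
  rw [map_add, coeff_psMap, coeff_psMap, coeff_psMap, bchSeries, PowerSeries.coeff_mk] at h4
  exact h4

/-! ### The Dynkin operator -/

/-- The antipode of the free algebra: the antimorphism with `X ↦ -X`, `Y ↦ -Y`. -/
def antipodeXY : FreeXY K →ₗ[K] FreeXY K :=
  (MulOpposite.opLinearEquiv K).symm.toLinearMap ∘ₗ
    (FreeAlgebra.lift K fun i : Fin 2 => MulOpposite.op (-FreeAlgebra.ι K i) :
      FreeXY K →ₐ[K] (FreeXY K)ᵐᵒᵖ).toLinearMap

theorem antipodeXY_mul (a b : FreeXY K) :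
    antipodeXY K (a * b) = antipodeXY K b * antipodeXY K a := by
  simp [antipodeXY]

theorem antipodeXY_one : antipodeXY K 1 = 1 := by simp [antipodeXY]

theorem antipodeXY_ι (i : Fin 2) :
    antipodeXY K (FreeAlgebra.ι K i) = -FreeAlgebra.ι K i := by simp [antipodeXY]

/-- The morphism `a ↦ a + ε Y(a)` to the dual numbers, where `Y` is the degree derivation. -/
def dualXY : FreeXY K →ₐ[K] TrivSqZeroExt (FreeXY K) (FreeXY K) :=
  FreeAlgebra.lift K fun i => TrivSqZeroExt.inl (FreeAlgebra.ι K i) +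
    TrivSqZeroExt.inr (FreeAlgebra.ι K i)

theorem fst_dualXY (a : FreeXY K) : (dualXY K a).fst = a := by
  have : (TrivSqZeroExt.fstHom K (FreeXY K) (FreeXY K)).comp (dualXY K) = AlgHom.id K _ := by
    ext i
    simp [dualXY]
  exact DFunLike.congr_fun this a

/-- The derivation of the free algebra which multiplies each word by its length. -/
def degreeXY : FreeXY K →ₗ[K] FreeXY K :=
  TrivSqZeroExt.sndHom (FreeXY K) (FreeXY K) |>.restrictScalars K |>.comp (dualXY K).toLinearMap

theorem degreeXY_mul (a b : FreeXY K) :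
    degreeXY K (a * b) = a * degreeXY K b + degreeXY K a * b := by
  simp [degreeXY, fst_dualXY]

theorem degreeXY_ι (i : Fin 2) : degreeXY K (FreeAlgebra.ι K i) = FreeAlgebra.ι K i := by
  simp [degreeXY, dualXY]

theorem degreeXY_one : degreeXY K 1 = 0 := by
  simp [degreeXY]

/-- The Dynkin operator, as a linear map on the tensor square: `S(a) Y(b)`. -/
def dynkinTensor : FreeXY K ⊗[K] FreeXY K →ₗ[K] FreeXY K :=
  LinearMap.mul' K _ ∘ₗ TensorProduct.map (antipodeXY K) (degreeXY K)

/-- The linear map `S(a) b` on the tensor square. -/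
def antipodeTensor : FreeXY K ⊗[K] FreeXY K →ₗ[K] FreeXY K :=
  LinearMap.mul' K _ ∘ₗ TensorProduct.map (antipodeXY K) LinearMap.id

/-- The antipode reverses products and negates the letter, so multiplication by the coproduct of a
letter becomes a commutator. -/
theorem antipodeTensor_mul (t : FreeXY K ⊗[K] FreeXY K) (i : Fin 2) :
    antipodeTensor K (t * shuffleDelta K (FreeAlgebra.ι K i)) =
      antipodeTensor K t * FreeAlgebra.ι K i - FreeAlgebra.ι K i * antipodeTensor K t := by
  induction t with
  | zero => simp
  | add s t hs ht => rw [add_mul, map_add, hs, ht, map_add]; noncomm_ring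
  | tmul a b =>
    rw [shuffleDelta_ι, mul_add, map_add]
    simp only [antipodeTensor, Algebra.TensorProduct.tmul_mul_tmul, LinearMap.comp_apply,
      TensorProduct.map_tmul, LinearMap.mul'_apply, antipodeXY_mul, antipodeXY_ι, mul_one,
      LinearMap.id_apply]
    noncomm_ring

/-- As in `antipodeTensor_mul`; the extra term is the derivative of the letter. -/
theorem dynkinTensor_mul (t : FreeXY K ⊗[K] FreeXY K) (i : Fin 2) :
    dynkinTensor K (t * shuffleDelta K (FreeAlgebra.ι K i)) =
      dynkinTensor K t * FreeAlgebra.ι K i - FreeAlgebra.ι K i * dynkinTensor K t +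
        antipodeTensor K t * FreeAlgebra.ι K i := by
  induction t with
  | zero => simp
  | add s t hs ht => rw [add_mul, map_add, hs, ht, map_add, map_add]; noncomm_ring
  | tmul a b =>
    rw [shuffleDelta_ι, mul_add, map_add]
    simp only [antipodeTensor, dynkinTensor, Algebra.TensorProduct.tmul_mul_tmul,
      LinearMap.comp_apply, TensorProduct.map_tmul, LinearMap.mul'_apply, antipodeXY_mul,
      antipodeXY_ι, mul_one, LinearMap.id_apply, degreeXY_mul, degreeXY_ι]
    noncomm_ring

/-- A subspace of the free algebra which is stable under right multiplication by the variables is a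
right ideal. -/
theorem mul_mem_of_mul_ι_mem {W : Submodule K (FreeXY K)}
    (hW : ∀ p ∈ W, ∀ i, p * FreeAlgebra.ι K i ∈ W) (q : FreeXY K) :
    ∀ p ∈ W, p * q ∈ W := by
  induction q using FreeAlgebra.induction with
  | grade0 c =>
    intro p hp
    rw [← Algebra.commutes, ← Algebra.smul_def]
    exact W.smul_mem c hp
  | grade1 i => exact fun p hp => hW p hp i
  | mul a b ha hb =>
    intro p hp
    rw [← mul_assoc]
    exact hb _ (ha _ hp)
  | add a b ha hb =>
    intro p hp
    rw [mul_add]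
    exact W.add_mem (ha _ hp) (hb _ hp)

/-- The value at `1` is a scalar, and each further letter replaces a scalar by its commutator with
that letter, which is `0`. -/
theorem antipodeTensor_shuffleDelta (p : FreeXY K) :
    antipodeTensor K (shuffleDelta K p) ∈ LinearMap.range (Algebra.linearMap K (FreeXY K)) := by
  have h := mul_mem_of_mul_ι_mem K (W := (LinearMap.range (Algebra.linearMap K (FreeXY K))).comap
    (antipodeTensor K ∘ₗ (shuffleDelta K).toLinearMap)) ?_ p 1 ?_
  · simpa using h
  · rintro q ⟨c, hc⟩ i
    rw [LinearMap.comp_apply, AlgHom.toLinearMap_apply] at hc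
    refine ⟨0, ?_⟩
    rw [LinearMap.comp_apply, AlgHom.toLinearMap_apply, map_mul, antipodeTensor_mul, ← hc,
      Algebra.linearMap_apply, Algebra.linearMap_apply, map_zero, Algebra.commutes, sub_self]
  · refine ⟨1, ?_⟩
    simp [antipodeTensor, Algebra.TensorProduct.one_def, antipodeXY_one]

attribute [local instance] LieRing.ofAssociativeRing

theorem freeLieToFree_of (i : Fin 2) :
    freeLieToFree K (FreeLieAlgebra.of K i) = FreeAlgebra.ι K i :=
  FreeLieAlgebra.lift_of_apply _ _

theorem dynkinTensor_shuffleDelta (p : FreeXY K) :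
    dynkinTensor K (shuffleDelta K p) ∈
      LinearMap.range (freeLieToFree K : FreeLieAlgebra K (Fin 2) →ₗ[K] FreeXY K) := by
  have h := mul_mem_of_mul_ι_mem K (W := (LinearMap.range
    (freeLieToFree K : FreeLieAlgebra K (Fin 2) →ₗ[K] FreeXY K)).comap
    (dynkinTensor K ∘ₗ (shuffleDelta K).toLinearMap)) ?_ p 1 ?_
  · simpa using h
  · rintro q ⟨b, hb⟩ i
    obtain ⟨c, hc⟩ := antipodeTensor_shuffleDelta K q
    rw [LinearMap.comp_apply, AlgHom.toLinearMap_apply] at hb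
    rw [Algebra.linearMap_apply] at hc
    -- These are the commutator and the extra term of `dynkinTensor_mul`, where the scalar `c` is
    -- the value of `antipodeTensor`.
    refine ⟨⁅b, FreeLieAlgebra.of K i⁆ + c • FreeLieAlgebra.of K i, ?_⟩
    rw [LinearMap.comp_apply, AlgHom.toLinearMap_apply, map_mul, dynkinTensor_mul, ← hb, ← hc,
      map_add, map_smul, ← Algebra.smul_def]
    change freeLieToFree K _ + c • freeLieToFree K _ = _
    rw [LieHom.map_lie, freeLieToFree_of, LieRing.of_associative_ring_bracket]
    rfl
  · refine ⟨0, ?_⟩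
    simp [dynkinTensor, Algebra.TensorProduct.one_def, degreeXY_one]

/-! ### Homogeneity, and the Baker-Campbell-Hausdorff theorem -/

/-- The homogeneous elements of degree `n`, as an eigenspace of the degree derivation. -/
def homogeneousXY (n : ℕ) : Submodule K (FreeXY K) :=
  LinearMap.ker (degreeXY K - (n : K) • LinearMap.id)

theorem mem_homogeneousXY {n : ℕ} {a : FreeXY K} :
    a ∈ homogeneousXY K n ↔ degreeXY K a = (n : K) • a := by
  rw [homogeneousXY, LinearMap.mem_ker, LinearMap.sub_apply, sub_eq_zero]
  rfl

theorem mul_mem_homogeneousXY {m n : ℕ} {a b : FreeXY K} (ha : a ∈ homogeneousXY K m)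
    (hb : b ∈ homogeneousXY K n) : a * b ∈ homogeneousXY K (m + n) := by
  rw [mem_homogeneousXY] at *
  rw [degreeXY_mul, ha, hb, mul_smul_comm, smul_mul_assoc, ← add_smul]
  push_cast
  rw [add_comm]

theorem one_mem_homogeneousXY : (1 : FreeXY K) ∈ homogeneousXY K 0 := by
  rw [mem_homogeneousXY, degreeXY_one, Nat.cast_zero, zero_smul]

theorem ι_pow_mem_homogeneousXY (i : Fin 2) (n : ℕ) :
    FreeAlgebra.ι K i ^ n ∈ homogeneousXY K n := by
  induction n with
  | zero => exact one_mem_homogeneousXY K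
  | succ n ih =>
    rw [pow_succ]
    refine mul_mem_homogeneousXY K ih ?_
    rw [mem_homogeneousXY, degreeXY_ι, Nat.cast_one, one_smul]

/-- The power series whose coefficients at `tⁿ` are homogeneous of degree `n`. -/
def homogeneousSeries : Subring (PowerSeries (FreeXY K)) where
  carrier := {f | ∀ n, PowerSeries.coeff n f ∈ homogeneousXY K n}
  mul_mem' {f g} hf hg n := by
    rw [PowerSeries.coeff_mul]
    refine Submodule.sum_mem _ fun p hp => ?_
    rw [← (HasAntidiagonal.mem_antidiagonal.mp hp)]
    exact mul_mem_homogeneousXY K (hf _) (hg _)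
  one_mem' n := by
    rw [PowerSeries.coeff_one]
    split_ifs with h
    · subst h
      exact one_mem_homogeneousXY K
    · exact Submodule.zero_mem _
  add_mem' {f g} hf hg n := by
    rw [map_add]
    exact Submodule.add_mem _ (hf n) (hg n)
  zero_mem' n := by
    rw [map_zero]
    exact Submodule.zero_mem _
  neg_mem' {f} hf n := by
    rw [map_neg]
    exact Submodule.neg_mem _ (hf n)

theorem expSeries_ι_mem (i : Fin 2) :
    expSeries K (FreeAlgebra.ι K i) ∈ homogeneousSeries K := fun n => by
  rw [expSeries, PowerSeries.coeff_mk]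
  exact Submodule.smul_mem _ _ (ι_pow_mem_homogeneousXY K i n)

theorem bchAssoc_mem_homogeneousXY (n : ℕ) : bchAssoc K n ∈ homogeneousXY K n := by
  refine Submodule.sum_mem _ fun k _ => Submodule.smul_mem _ _ ?_
  exact (homogeneousSeries K).pow_mem ((homogeneousSeries K).sub_mem ((homogeneousSeries K).mul_mem
    (expSeries_ι_mem K 0) (expSeries_ι_mem K 1)) (homogeneousSeries K).one_mem) k n

/-- The degree derivation kills `1`, so only the summand `1 ⊗ p` contributes. -/
theorem dynkinTensor_primitive {n : ℕ} {p : FreeXY K} (hp : p ∈ homogeneousXY K n) :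
    dynkinTensor K (p ⊗ₜ 1 + 1 ⊗ₜ p) = (n : K) • p := by
  rw [map_add]
  simp [dynkinTensor, antipodeXY_one, degreeXY_one, (mem_homogeneousXY K).mp hp]

/-- The Baker-Campbell-Hausdorff theorem. -/
theorem exists_freeLieToFree_eq_bchAssoc [CharZero K] (n : ℕ) :
    ∃ b : FreeLieAlgebra K (Fin 2), freeLieToFree K b = bchAssoc K n := by
  rcases Nat.eq_zero_or_pos n with rfl | hn
  · exact ⟨0, by simp [bchAssoc]⟩
  · obtain ⟨b, hb⟩ := dynkinTensor_shuffleDelta K (bchAssoc K n)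
    rw [shuffleDelta_bchAssoc, dynkinTensor_primitive K (bchAssoc_mem_homogeneousXY K n)] at hb
    refine ⟨(n : K)⁻¹ • b, ?_⟩
    rw [map_smul]
    change (n : K)⁻¹ • (freeLieToFree K : FreeLieAlgebra K (Fin 2) →ₗ[K] FreeXY K) b = _
    rw [hb, inv_smul_smul₀ (Nat.cast_ne_zero.mpr hn.ne')]

theorem freeLieToFree_bchLie [CharZero K] (n : ℕ) :
    freeLieToFree K (bchLie K n) = bchAssoc K n := by
  rw [bchLie, dif_pos (exists_freeLieToFree_eq_bchAssoc K n)]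
  exact (exists_freeLieToFree_eq_bchAssoc K n).choose_spec

end BCH

/-! ### Sums over the subwords of a word -/

section CutSum

open Finset

variable {α : Type*} {M : Type*} [AddCommMonoid M]

/-- The sum of `F s g` over all ways of removing a subword `s` from a word, which leaves the list of
gaps `g`. -/
def cutSum : List α → (List α → List (List α) → M) → M
  | [], F => F [] [[]]
  | a :: w, F => cutSum w (fun s g => F (a :: s) ([] :: g)) +
      cutSum w (fun s g => F s (g.modifyHead (a :: ·)))

theorem sum_finset_fin_succ (n : ℕ) (f : Finset (Fin (n + 1)) → M) :
    ∑ S, f S = ∑ S : Finset (Fin n), f (insert 0 (S.map (Fin.succEmb n))) +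
      ∑ S : Finset (Fin n), f (S.map (Fin.succEmb n)) := by
  have h0 : (0 : Fin (n + 1)) ∉ (univ : Finset (Fin n)).map (Fin.succEmb n) := by simp
  have hu : (univ : Finset (Finset (Fin (n + 1)))) =
      (insert 0 ((univ : Finset (Fin n)).map (Fin.succEmb n))).powerset := by
    rw [← Finset.powerset_univ, Fin.univ_succ, Finset.cons_eq_insert]
    rfl
  have hp : ((univ : Finset (Fin n)).map (Fin.succEmb n)).powerset =
      (univ : Finset (Finset (Fin n))).map (Finset.mapEmbedding (Fin.succEmb n)).toEmbedding := by
    ext T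
    simp only [Finset.mem_powerset, Finset.mem_map, Finset.mem_univ, true_and]
    constructor
    · intro h
      obtain ⟨S, -, rfl⟩ := Finset.subset_map_iff.mp h
      exact ⟨S, rfl⟩
    · rintro ⟨S, rfl⟩
      exact Finset.map_subset_map.mpr (Finset.subset_univ S)
  rw [hu, Finset.sum_powerset_insert h0, hp, Finset.sum_map, Finset.sum_map, add_comm]
  rfl

theorem subword_cons_insert (a : ℕ+) (w : List ℕ+) (S : Finset (Fin w.length)) :
    subword (a :: w) (insert (0 : Fin (w.length + 1)) (S.map (Fin.succEmb _))) =
      a :: subword w S := by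
  simp only [subword, List.length_cons, List.finRange_succ, List.filter_cons]
  simp [List.filter_map, Function.comp_def, Fin.succ_ne_zero]

theorem subword_cons_map (a : ℕ+) (w : List ℕ+) (S : Finset (Fin w.length)) :
    subword (a :: w) (S.map (Fin.succEmb _)) = subword w S := by
  simp only [subword, List.length_cons, List.finRange_succ, List.filter_cons]
  simp [List.filter_map, Function.comp_def, Fin.succ_ne_zero]

theorem splitOnP_map {β γ : Type*} (f : β → γ) (p : γ → Bool) (l : List β) :
    (l.map f).splitOnP p = (l.splitOnP (p ∘ f)).map (List.map f) := by
  induction l with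
  | nil => simp
  | cons b l ih =>
    rw [List.map_cons, List.splitOnP_cons_eq_if_modifyHead, List.splitOnP_cons_eq_if_modifyHead, ih]
    simp only [Function.comp_apply]
    split_ifs
    · simp
    · cases l.splitOnP (p ∘ f) <;> simp

theorem gaps_cons_insert (a : ℕ+) (w : List ℕ+) (S : Finset (Fin w.length)) :
    gaps (a :: w) (insert (0 : Fin (w.length + 1)) (S.map (Fin.succEmb _))) =
      [] :: gaps w S := by
  simp only [gaps, List.length_cons, List.finRange_succ, List.splitOnP_cons_eq_if_modifyHead]
  simp [splitOnP_map, Function.comp_def, Fin.succ_ne_zero]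

theorem gaps_cons_map (a : ℕ+) (w : List ℕ+) (S : Finset (Fin w.length)) :
    gaps (a :: w) (S.map (Fin.succEmb _)) = (gaps w S).modifyHead (a :: ·) := by
  simp only [gaps, List.length_cons, List.finRange_succ, List.splitOnP_cons_eq_if_modifyHead]
  simp only [splitOnP_map, Function.comp_def]
  cases h : (List.finRange w.length).splitOnP (· ∈ S) with
  | nil => simp [h]
  | cons b l => simp [h]

/-- Replaces sums over subsets by a recursion on the word: the first letter is either in `S`, which
leaves an empty gap before it, or joins the first gap. -/
theorem sum_subsets_eq_cutSum (w : List ℕ+) : ∀ F : List ℕ+ → List (List ℕ+) → M,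
    ∑ S : Finset (Fin w.length), F (subword w S) (gaps w S) = cutSum w F := by
  induction w with
  | nil => intro F; simp [cutSum, subword, gaps]
  | cons a w ih =>
    intro F
    rw [cutSum, ← ih, ← ih]
    refine (sum_finset_fin_succ w.length _).trans ?_
    congr 1
    · exact Finset.sum_congr rfl fun S _ =>
        congrArg₂ F (subword_cons_insert a w S) (gaps_cons_insert a w S)
    · exact Finset.sum_congr rfl fun S _ =>
        congrArg₂ F (subword_cons_map a w S) (gaps_cons_map a w S)

theorem map_cutSum {N : Type*} [AddCommMonoid N] {E : Type*} [FunLike E M N]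
    [AddMonoidHomClass E M N] (f : E) (w : List α) : ∀ F : List α → List (List α) → M,
    f (cutSum w F) = cutSum w (fun s g => f (F s g)) := by
  induction w with
  | nil => intro F; rfl
  | cons a w ih => intro F; rw [cutSum, cutSum, map_add, ih, ih]

theorem cutSum_add (w : List α) : ∀ F G : List α → List (List α) → M,
    cutSum w (fun s g => F s g + G s g) = cutSum w F + cutSum w G := by
  induction w with
  | nil => intro F G; rfl
  | cons a w ih => intro F G; simp only [cutSum, ih]; abel

/-- The total length of a list of words. -/
def totalLength (l : List (List α)) : ℕ := (l.map List.length).sum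

theorem totalLength_cons (u : List α) (l : List (List α)) :
    totalLength (u :: l) = u.length + totalLength l := by simp [totalLength]

theorem totalLength_append (l l' : List (List α)) :
    totalLength (l ++ l') = totalLength l + totalLength l' := by simp [totalLength]

/-- Only pairs that can occur need be compared: there is always a first gap, and no letter is lost.
-/
theorem cutSum_congr (w : List α) : ∀ {F G : List α → List (List α) → M},
    (∀ s g, g ≠ [] → s.length + totalLength g = w.length → F s g = G s g) →
    cutSum w F = cutSum w G := by
  induction w with
  | nil => intro F G h; exact h _ _ (by simp) rfl
  | cons a w ih =>
    intro F G h
    rw [cutSum, cutSum]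
    congr 1
    · refine ih fun s g _ hl => h _ _ (by simp) ?_
      simp only [List.length_cons, totalLength_cons, List.length_nil]
      omega
    · refine ih fun s g hg hl => ?_
      obtain ⟨u, g, rfl⟩ := List.exists_cons_of_ne_nil hg
      refine h _ _ (by simp) ?_
      simp only [List.modifyHead_cons, List.length_cons, totalLength_cons] at *
      omega

theorem cutSum_zero (w : List α) : cutSum w (fun _ _ => (0 : M)) = 0 := by
  induction w with
  | nil => rfl
  | cons a w ih => simp only [cutSum, ih, add_zero]

theorem cutSum_of_cons_eq_zero (w : List α) : ∀ (F : List α → List (List α) → M),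
    (∀ a s g, F (a :: s) g = 0) → cutSum w F = F [] [w] := by
  induction w with
  | nil => intro F _; rfl
  | cons a w ih =>
    intro F h
    simp only [cutSum, h, cutSum_zero, zero_add]
    exact ih _ fun b s g => h _ _ _

/-- The sum over all ways of removing subwords `ks` from the words of a list, which leave the
lists of gaps with concatenation `ls`. -/
def gapsSum : List (List α) → (List (List α) → List (List α) → M) → M
  | [], G => G [] []
  | u :: us, G => cutSum u fun k l => gapsSum us fun ks ls => G (k :: ks) (l ++ ls)

theorem gapsSum_congr (us : List (List α)) : ∀ {F G : List (List α) → List (List α) → M},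
    (∀ ks ls, totalLength ks + totalLength ls = totalLength us → F ks ls = G ks ls) →
    gapsSum us F = gapsSum us G := by
  induction us with
  | nil => intro F G h; exact h _ _ rfl
  | cons u us ih =>
    intro F G h
    refine cutSum_congr u fun k l _ hk => ih fun ks ls hs => h _ _ ?_
    simp only [totalLength_cons, totalLength_append]
    omega

theorem gapsSum_zero (us : List (List α)) : gapsSum us (fun _ _ => (0 : M)) = 0 := by
  induction us with
  | nil => rfl
  | cons u us ih => simp only [gapsSum, ih, cutSum_zero]

theorem map_gapsSum {N : Type*} [AddCommMonoid N] {E : Type*} [FunLike E M N]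
    [AddMonoidHomClass E M N] (f : E) (us : List (List α)) :
    ∀ F : List (List α) → List (List α) → M,
    f (gapsSum us F) = gapsSum us (fun s g => f (F s g)) := by
  induction us with
  | nil => intro F; rfl
  | cons a w ih => intro F; simp only [gapsSum, map_cutSum, ih]

/-- The combinatorial form of coassociativity. Both sides distribute the letters over three classes;
the gaps of `t` in `s` are the parts of `s` inside the gaps of `t` in `w`. Keeping the empty gaps
makes the lists agree exactly. -/
theorem cutSum_cutSum (w : List α) : ∀ F : List α → List (List α) → List (List α) → M,
    cutSum w (fun s g => cutSum s fun t h => F t h g) =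
      cutSum w fun t g => gapsSum g (F t) := by
  induction w with
  | nil => intro F; simp [cutSum, gapsSum]
  | cons a w ih =>
    intro F
    simp only [cutSum, cutSum_add, ih, gapsSum, List.singleton_append]
    rw [add_assoc]
    congr 1
    -- A letter `a` outside `t` heads the first gap of `t`; the two remaining summands are the two
    -- ways of treating it when that gap is cut.
    rw [← cutSum_add]
    refine cutSum_congr w fun t g hg _ => ?_
    obtain ⟨u, g, rfl⟩ := List.exists_cons_of_ne_nil hg
    simp only [List.modifyHead_cons, gapsSum, cutSum, List.cons_append]
    congr 1
    refine cutSum_congr u fun k l hl _ => ?_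
    obtain ⟨v, l, rfl⟩ := List.exists_cons_of_ne_nil hl
    simp

end CutSum

/-! ### The bialgebra `T(V)` -/

section Bialgebra

variable (K : Type*) [Field K]

/-- The product in `T(V)` of a list of words. -/
def wordProd (l : List (List ℕ+)) : TV K := (l.map (word K)).prod

theorem wordProd_cons (u : List ℕ+) (l : List (List ℕ+)) :
    wordProd K (u :: l) = word K u * wordProd K l := by simp [wordProd]

theorem wordProd_append (l l' : List (List ℕ+)) :
    wordProd K (l ++ l') = wordProd K l * wordProd K l' := by simp [wordProd]

theorem wordProd_singleton (u : List ℕ+) : wordProd K [u] = word K u := by simp [wordProd]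

theorem wordProd_nil : wordProd K [] = 1 := rfl

theorem word_nil : word K [] = 1 := rfl

theorem deltaWord_eq (w : List ℕ+) :
    deltaWord K w = cutSum w fun s g => word K s ⊗ₜ[K] wordProd K g :=
  sum_subsets_eq_cutSum w fun s g => word K s ⊗ₜ[K] wordProd K g

theorem delta_word (w : List ℕ+) :
    delta K (word K w) = cutSum w fun s g => word K s ⊗ₜ[K] wordProd K g := by
  rw [← deltaWord_eq]
  cases w with
  | nil =>
    rw [deltaWord_eq, word_nil, map_one]
    simp [cutSum, wordProd_singleton, word_nil, Algebra.TensorProduct.one_def]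
  | cons a w => simp [word, delta]

theorem delta_wordProd (us : List (List ℕ+)) :
    delta K (wordProd K us) = gapsSum us fun ks ls => wordProd K ks ⊗ₜ[K] wordProd K ls := by
  induction us with
  | nil => simp [gapsSum, wordProd_nil, Algebra.TensorProduct.one_def]
  | cons u us ih =>
    rw [wordProd_cons, map_mul, delta_word, ih, gapsSum]
    have h := map_cutSum (LinearMap.mulRight K
      (gapsSum us fun ks ls => wordProd K ks ⊗ₜ[K] wordProd K ls)) u
      fun s g => word K s ⊗ₜ[K] wordProd K g
    rw [LinearMap.mulRight_apply] at h
    rw [h]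
    congr 1
    funext k l
    rw [LinearMap.mulRight_apply, ← LinearMap.mulLeft_apply (R := K), map_gapsSum]
    simp [wordProd_cons, wordProd_append]

/-- Two algebra morphisms on `T(V)` agree if they do so on the words. -/
theorem algHom_ext_word {B : Type*} [Semiring B] [Algebra K B] {f g : TV K →ₐ[K] B}
    (h : ∀ w, f (word K w) = g (word K w)) : f = g := by
  refine TensorAlgebra.hom_ext (Finsupp.lhom_ext' fun w => LinearMap.ext_ring ?_)
  obtain ⟨w, hw⟩ := w
  cases w with
  | nil => exact absurd rfl hw
  | cons a w => exact h (a :: w)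

/-- The span contains `1` and is stable under right multiplication by every element. -/
theorem span_wordProd : Submodule.span K (Set.range (wordProd K)) = ⊤ := by
  have key : ∀ q : TV K, ∀ p ∈ Submodule.span K (Set.range (wordProd K)),
      p * q ∈ Submodule.span K (Set.range (wordProd K)) := by
    intro q
    induction q using TensorAlgebra.induction with
    | algebraMap c =>
      intro p hp
      rw [← Algebra.commutes, ← Algebra.smul_def]
      exact Submodule.smul_mem _ c hp
    | ι v =>
      induction v using Finsupp.induction_linear with
      | zero => intro p _; simp
      | add v v' hv hv' =>
        intro p hp
        rw [map_add, mul_add]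
        exact add_mem (hv p hp) (hv' p hp)
      | single w c =>
        obtain ⟨w, hw⟩ := w
        cases w with
        | nil => exact absurd rfl hw
        | cons a w =>
          intro p hp
          have : TensorAlgebra.ι K (Finsupp.single (⟨a :: w, hw⟩ : {w : List ℕ+ // w ≠ []}) c) =
              c • word K (a :: w) := by
            rw [word, ← map_smul, Finsupp.smul_single, smul_eq_mul, mul_one]
          rw [this, mul_smul_comm]
          refine Submodule.smul_mem _ _ ?_
          induction hp using Submodule.span_induction with
          | mem x hx =>
            obtain ⟨l, rfl⟩ := hx
            refine Submodule.subset_span ⟨l ++ [a :: w], ?_⟩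
            rw [wordProd_append, wordProd_singleton]
          | zero => simp
          | add x y _ _ hx hy => rw [add_mul]; exact add_mem hx hy
          | smul c x _ hx => rw [smul_mul_assoc]; exact Submodule.smul_mem _ _ hx
    | mul a b ha hb =>
      intro p hp
      rw [← mul_assoc]
      exact hb _ (ha _ hp)
    | add a b ha hb =>
      intro p hp
      rw [mul_add]
      exact add_mem (ha _ hp) (hb _ hp)
  rw [eq_top_iff]
  intro x _
  have := key x 1 (Submodule.subset_span ⟨[], rfl⟩)
  rwa [one_mul] at this

/-- The counit of `T(V)`. -/
abbrev counitTV : TV K →ₐ[K] K := TensorAlgebra.algebraMapInv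

theorem counitTV_word_cons (a : ℕ+) (w : List ℕ+) : counitTV K (word K (a :: w)) = 0 := by
  simp [word, TensorAlgebra.algebraMapInv]

theorem counitTV_wordProd (l : List (List ℕ+)) (h : totalLength l ≠ 0) :
    counitTV K (wordProd K l) = 0 := by
  induction l with
  | nil => exact absurd rfl h
  | cons u l ih =>
    rw [wordProd_cons, map_mul]
    cases u with
    | nil => rw [ih (by simpa [totalLength_cons] using h), mul_zero]
    | cons a w => rw [counitTV_word_cons, zero_mul]

/-- Both sides are algebra morphisms, so it suffices to compare them on words, where this is
`cutSum_cutSum`. -/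
theorem delta_coassoc :
    (Algebra.TensorProduct.assoc K K K (TV K) (TV K) (TV K)).toAlgHom.comp
      ((Algebra.TensorProduct.map (delta K) (AlgHom.id K (TV K))).comp (delta K)) =
    (Algebra.TensorProduct.map (AlgHom.id K (TV K)) (delta K)).comp (delta K) := by
  refine algHom_ext_word K fun w => ?_
  have h := cutSum_cutSum w fun t h g =>
    word K t ⊗ₜ[K] (wordProd K h ⊗ₜ[K] wordProd K g)
  simp only [AlgHom.comp_apply, delta_word, map_cutSum]
  refine Eq.trans (cutSum_congr w fun s g _ _ => ?_)
    (h.trans (cutSum_congr w fun s g _ _ => ?_))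
  · simp only [Algebra.TensorProduct.map_tmul, delta_word, AlgHom.id_apply]
    have h1 := map_cutSum ((TensorProduct.mk K (TV K ⊗[K] TV K) (TV K)).flip (wordProd K g)) s
      fun s g => word K s ⊗ₜ[K] wordProd K g
    rw [LinearMap.flip_apply, TensorProduct.mk_apply] at h1
    rw [h1, map_cutSum]
    rfl
  · simp only [Algebra.TensorProduct.map_tmul, delta_wordProd, AlgHom.id_apply]
    exact (map_gapsSum (TensorProduct.mk K (TV K) (TV K ⊗[K] TV K) (word K s)) g _).symm

theorem delta_counit_left :
    (Algebra.TensorProduct.lid K (TV K)).toAlgHom.comp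
      ((Algebra.TensorProduct.map (counitTV K) (AlgHom.id K (TV K))).comp (delta K)) =
    AlgHom.id K (TV K) := by
  refine algHom_ext_word K fun w => ?_
  simp only [AlgHom.comp_apply, delta_word, map_cutSum]
  refine (cutSum_of_cons_eq_zero w _ fun a s g => ?_).trans ?_
  · simp [counitTV_word_cons]
  · simp [word_nil, wordProd_singleton]

/-- The counit kills every nonempty gap, so only the removal of all letters survives. -/
theorem cutSum_counitTV {N : Type*} [AddCommGroup N] [Module K N] (w : List ℕ+) :
    ∀ F : List ℕ+ → N,
    cutSum w (fun s g => counitTV K (wordProd K g) • F s) = F w := by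
  induction w with
  | nil => intro F; simp [cutSum, wordProd_singleton, word_nil]
  | cons a w ih =>
    intro F
    rw [cutSum]
    simp only [wordProd_cons, word_nil, one_mul, ih]
    rw [cutSum_congr w (G := fun _ _ => 0), cutSum_zero, add_zero]
    intro s g hg _
    obtain ⟨u, g, rfl⟩ := List.exists_cons_of_ne_nil hg
    rw [List.modifyHead_cons, counitTV_wordProd, zero_smul]
    simp [totalLength_cons]

theorem delta_counit_right :
    (Algebra.TensorProduct.rid K K (TV K)).toAlgHom.comp
      ((Algebra.TensorProduct.map (AlgHom.id K (TV K)) (counitTV K)).comp (delta K)) =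
    AlgHom.id K (TV K) := by
  refine algHom_ext_word K fun w => ?_
  simp only [AlgHom.comp_apply, delta_word, map_cutSum]
  refine Eq.trans ?_ (cutSum_counitTV K w (word K))
  simp

/-- `T(V)` with the coproduct `Δ`. -/
instance : Coalgebra K (TV K) where
  comul := (delta K).toLinearMap
  counit := (counitTV K).toLinearMap
  coassoc := by
    ext x
    exact DFunLike.congr_fun (delta_coassoc K) x
  rTensor_counit_comp_comul := by
    refine LinearMap.ext fun x => (TensorProduct.lid K (TV K)).injective ?_
    refine (DFunLike.congr_fun (delta_counit_left K) x).trans ?_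
    simp
  lTensor_counit_comp_comul := by
    refine LinearMap.ext fun x => (TensorProduct.rid K (TV K)).injective ?_
    refine (DFunLike.congr_fun (delta_counit_right K) x).trans ?_
    simp

end Bialgebra

/-! ### The convolution algebra and its filtration -/

section Convolution

open Finset WithConv

variable (K : Type*) [Field K] (A : Type*) [CommRing A] [Algebra K A]

/-- The convolution algebra of the linear maps `T(V) → A`. -/
abbrev ConvAlg : Type _ := WithConv (TV K →ₗ[K] A)

variable {K A}

/-- `conv` unfolds to the product of the convolution ring given by the coalgebra structure, so ring
lemmas become available. -/
theorem toConv_conv (φ ψ : TV K →ₗ[K] A) : toConv (conv φ ψ) = toConv φ * toConv ψ := rfl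

theorem toConv_counit : toConv (counit K A) = 1 := rfl

theorem toConv_convPow (φ : TV K →ₗ[K] A) (n : ℕ) : toConv (convPow φ n) = toConv φ ^ n := by
  induction n with
  | zero => rfl
  | succ n ih => rw [convPow, toConv_conv, ih, pow_succ']

variable (K A) in
/-- The filtration of the convolution algebra: linear maps which vanish on all products of words
with less than `n` letters altogether. -/
def lengthFiltration (n : ℕ) : Submodule K (ConvAlg K A) where
  carrier := {φ | ∀ l, totalLength l < n → φ.ofConv (wordProd K l) = 0}
  add_mem' {φ ψ} hφ hψ l hl := by
    rw [ofConv_add, LinearMap.add_apply, hφ l hl, hψ l hl, add_zero]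
  zero_mem' _ _ := rfl
  smul_mem' c φ hφ l hl := by rw [ofConv_smul, LinearMap.smul_apply, hφ l hl, smul_zero]

theorem eq_of_eq_on_wordProd {φ ψ : TV K →ₗ[K] A}
    (h : ∀ l, φ (wordProd K l) = ψ (wordProd K l)) : φ = ψ := by
  refine LinearMap.ext_on (span_wordProd K) ?_
  rintro _ ⟨l, rfl⟩
  exact h l

theorem mul_apply_wordProd (φ ψ : ConvAlg K A) (l : List (List ℕ+)) :
    (φ * ψ).ofConv (wordProd K l) =
      gapsSum l fun ks ls => φ.ofConv (wordProd K ks) * ψ.ofConv (wordProd K ls) := by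
  change LinearMap.mul' K A (TensorProduct.map φ.ofConv ψ.ofConv (delta K (wordProd K l))) = _
  rw [delta_wordProd, map_gapsSum, map_gapsSum]
  rfl

-- Multiplicative because cutting conserves the number of letters, separated because products of
-- words span `T(V)`.
variable (K A) in
theorem lengthFiltration_isFiltration : IsFiltration (lengthFiltration K A) where
  zero_eq_top := by
    rw [eq_top_iff]
    intro f _ k hk
    exact absurd hk (Nat.not_lt_zero _)
  antitone m n hmn f hf l hl := hf l (hl.trans_le hmn)
  mul_mem {m n φ ψ} hφ hψ l hl := by
    rw [mul_apply_wordProd, gapsSum_congr l (G := fun _ _ => 0), gapsSum_zero]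
    intro ks ls h
    by_cases hk : totalLength ks < m
    · rw [hφ _ hk, zero_mul]
    · rw [hψ ls (by omega), mul_zero]
  eq_zero {φ} h := by
    refine ofConv_injective (eq_of_eq_on_wordProd fun l => ?_)
    exact h (totalLength l + 1) l (Nat.lt_succ_self _)

theorem mem_lengthFiltration_one {φ : TV K →ₗ[K] A} (h : φ 1 = 0) :
    toConv φ ∈ lengthFiltration K A 1 := by
  intro l hl
  have : wordProd K l = 1 := by
    induction l with
    | nil => rfl
    | cons u l ih =>
      rw [totalLength_cons] at hl
      have hu : u = [] := List.eq_nil_of_length_eq_zero (by omega)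
      rw [wordProd_cons, hu, word_nil, one_mul, ih (by omega)]
  rw [this]
  exact h

-- An element of `T(V)` involves finitely many products of words, so their lengths are bounded.
variable (A) in
theorem exists_forall_apply_eq_zero (x : TV K) :
    ∃ N, ∀ φ ∈ lengthFiltration K A N, φ.ofConv x = 0 := by
  have hI := lengthFiltration_isFiltration K A
  have hx : x ∈ Submodule.span K (Set.range (wordProd K)) := by rw [span_wordProd]; trivial
  induction hx using Submodule.span_induction with
  | mem x hx =>
    obtain ⟨l, rfl⟩ := hx
    exact ⟨totalLength l + 1, fun φ hφ => hφ l (Nat.lt_succ_self _)⟩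
  | zero => exact ⟨0, fun φ _ => map_zero _⟩
  | add x y _ _ hx hy =>
    obtain ⟨M, hM⟩ := hx
    obtain ⟨N, hN⟩ := hy
    refine ⟨max M N, fun φ hφ => ?_⟩
    rw [map_add, hM φ (hI.antitone (le_max_left _ _) hφ),
      hN φ (hI.antitone (le_max_right _ _) hφ), add_zero]
  | smul c x _ hx =>
    obtain ⟨N, hN⟩ := hx
    exact ⟨N, fun φ hφ => by rw [map_smul, hN φ hφ, smul_zero]⟩

/-- Pointwise finiteness follows from the filtration, so `pointwiseSum` does not take its default
value. -/
theorem sumsTo_pointwiseSum {F : ℕ → (TV K →ₗ[K] A)}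
    (hF : ∀ n, toConv (F n) ∈ lengthFiltration K A n) :
    SumsTo (lengthFiltration K A) (fun n => toConv (F n)) (toConv (pointwiseSum F)) := by
  have hI := lengthFiltration_isFiltration K A
  have hfin : ∀ x, (Function.support fun n => F n x).Finite := fun x => by
    obtain ⟨N, hN⟩ := exists_forall_apply_eq_zero A x
    refine (Set.finite_lt_nat N).subset fun n hn => ?_
    by_contra hnN
    exact hn (hN _ (hI.antitone (not_lt.mp hnN) (hF n)))
  intro N l hl
  rw [pointwiseSum, dif_pos hfin, ofConv_sub, LinearMap.sub_apply, sub_eq_zero, ofConv_sum,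
    LinearMap.sum_apply]
  refine finsum_eq_sum_of_support_subset _ fun n hn => ?_
  rw [Finset.coe_range, Set.mem_Iio]
  by_contra hnN
  exact hn (hI.antitone (not_lt.mp hnN) (hF n) l hl)

theorem SumsTo.apply_eq {u : ℕ → ConvAlg K A} {s : ConvAlg K A}
    (h : SumsTo (lengthFiltration K A) u s) (x : TV K) :
    ∃ N, s.ofConv x = ∑ n ∈ range N, (u n).ofConv x := by
  obtain ⟨N, hN⟩ := exists_forall_apply_eq_zero A x
  refine ⟨N, ?_⟩
  have := hN _ (h N)
  rwa [ofConv_sub, LinearMap.sub_apply, sub_eq_zero, ofConv_sum, LinearMap.sum_apply] at this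

theorem isExp_expConv {φ : TV K →ₗ[K] A} (hφ : φ 1 = 0) :
    IsExp (lengthFiltration K A) (toConv φ) (toConv (expConv φ)) := by
  have hI := lengthFiltration_isFiltration K A
  have h : ∀ n, toConv (((n.factorial : K)⁻¹) • convPow φ n) =
      ((n.factorial : K)⁻¹) • toConv φ ^ n := fun n => by rw [toConv_smul, toConv_convPow]
  refine (sumsTo_pointwiseSum fun n => ?_).congr h
  rw [h]
  exact Submodule.smul_mem _ _ (hI.pow_mem (mem_lengthFiltration_one hφ) n)

theorem isLog_logConv {γ : TV K →ₗ[K] A}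
    (hγ : toConv γ - 1 ∈ lengthFiltration K A 1) :
    IsLog (lengthFiltration K A) (toConv γ - 1) (toConv (logConv γ)) := by
  have hI := lengthFiltration_isFiltration K A
  have h : ∀ n : ℕ, toConv (((-1 : K) ^ n / ((n : K) + 1)) • convPow (γ - counit K A) (n + 1)) =
      logCoeff K (n + 1) • (toConv γ - 1) ^ (n + 1) := fun n => by
    rw [toConv_smul, toConv_convPow, toConv_sub, toConv_counit, logCoeff_succ]
  have hmem : ∀ n, logCoeff K n • (toConv γ - 1) ^ n ∈ lengthFiltration K A n :=
    fun n => Submodule.smul_mem _ _ (hI.pow_mem hγ n)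
  have hs := sumsTo_pointwiseSum fun n => by
    rw [h]
    exact hI.antitone (Nat.le_succ n) (hmem (n + 1))
  intro N
  -- `logConv` starts at the first power, `IsLog` at the zeroth: the partial sums differ by one
  -- term, which lies in step `N` of the filtration.
  rw [show ∑ n ∈ range N, logCoeff K n • (toConv γ - 1) ^ n =
    ∑ n ∈ range (N + 1), logCoeff K n • (toConv γ - 1) ^ n - logCoeff K N • (toConv γ - 1) ^ N by
    rw [Finset.sum_range_succ, add_sub_cancel_right], Finset.sum_range_succ', logCoeff_zero,
    zero_smul, add_zero, ← sub_add]
  have h1 := (hs.congr h) N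
  exact add_mem h1 (hmem N)

end Convolution

/-! ### The evaluation of the Baker-Campbell-Hausdorff series in a filtered algebra -/

section Evaluation

open Finset

variable {K : Type*} [Field K] {R : Type*} [Ring R] [Algebra K R] {I : ℕ → Submodule K R}

/-- A term is the difference of two consecutive remainders. -/
theorem SumsTo.term_mem (hI : IsFiltration I) {u : ℕ → R} {s : R} (h : SumsTo I u s) (n : ℕ) :
    u n ∈ I n := by
  have := sub_mem (h n) (hI.antitone (Nat.le_succ n) (h (n + 1)))
  rwa [Finset.sum_range_succ, sub_sub_sub_cancel_left, add_sub_cancel_left] at this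

theorem sumsTo_coeff_one (hI : IsFiltration I) :
    SumsTo I (fun n => PowerSeries.coeff n (1 : PowerSeries R)) 1 := fun N => by
  cases N with
  | zero => exact hI.mem_zero _
  | succ N => simp [PowerSeries.coeff_one]

theorem SumsTo.coeff_mul (hI : IsFiltration I) {f g : PowerSeries R} {s t : R}
    (hf : SumsTo I (fun n => PowerSeries.coeff n f) s)
    (hg : SumsTo I (fun n => PowerSeries.coeff n g) t) :
    SumsTo I (fun n => PowerSeries.coeff n (f * g)) (s * t) :=
  (SumsTo.mul hI (hf.term_mem hI) (hg.term_mem hI) hf hg).congr fun n =>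
    (PowerSeries.coeff_mul n f g).symm

theorem SumsTo.coeff_pow (hI : IsFiltration I) {f : PowerSeries R} {s : R}
    (hf : SumsTo I (fun n => PowerSeries.coeff n f) s) (k : ℕ) :
    SumsTo I (fun n => PowerSeries.coeff n (f ^ k)) (s ^ k) := by
  induction k with
  | zero => simpa only [pow_zero] using sumsTo_coeff_one hI
  | succ k ih => rw [pow_succ, pow_succ]; exact SumsTo.coeff_mul hI ih hf

theorem IsExp.coeff_expSeries {a e : R} (h : IsExp I a e) :
    SumsTo I (fun n => PowerSeries.coeff n (expSeries K a)) e :=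
  SumsTo.congr h fun n => by rw [expSeries, PowerSeries.coeff_mk]

/-- Evaluation at `t = 1`. The logarithm is a double sum over the power `k` and the degree `n`;
modulo `I N` both may be cut at `N`, and then the sums are exchanged. -/
theorem IsLog.sumsTo_bchAssoc [CharZero K] (hI : IsFiltration I) {e f s : R}
    (g : FreeXY K →ₐ[K] R) (he : IsExp I (g (FreeAlgebra.ι K 0)) e)
    (hf : IsExp I (g (FreeAlgebra.ι K 1)) f) (hs : IsLog I (e * f - 1) s) :
    SumsTo I (fun n => g (bchAssoc K n)) s := by
  have h1 : SumsTo I (fun n => PowerSeries.coeff n (psMap g (expXY K - 1))) (e * f - 1) := by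
    have h2 := SumsTo.coeff_mul hI he.coeff_expSeries hf.coeff_expSeries
    rw [← psMap_expSeries, ← psMap_expSeries, ← map_mul] at h2
    refine (h2.sub (sumsTo_coeff_one hI)).congr fun n => ?_
    rw [map_sub (psMap g), map_one (psMap g), map_sub, expXY]
  intro N
  have h3 : ∑ n ∈ range N, g (bchAssoc K n) = ∑ k ∈ range N, logCoeff K k •
      ∑ n ∈ range N, PowerSeries.coeff n ((psMap g (expXY K - 1)) ^ k) := by
    simp only [Finset.smul_sum]
    rw [Finset.sum_comm]
    refine Finset.sum_congr rfl fun n hn => ?_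
    rw [bchAssoc_eq_sum_range K (Finset.mem_range.mp hn), map_sum]
    refine Finset.sum_congr rfl fun k _ => ?_
    rw [map_smul, ← map_pow, coeff_psMap]
  have h4 : ∑ k ∈ range N, logCoeff K k • (e * f - 1) ^ k -
      ∑ n ∈ range N, g (bchAssoc K n) ∈ I N := by
    rw [h3, ← Finset.sum_sub_distrib]
    refine Submodule.sum_mem _ fun k _ => ?_
    rw [← smul_sub]
    exact Submodule.smul_mem _ _ (SumsTo.coeff_pow hI h1 k N)
  simpa using add_mem (hs N) h4

end Evaluation

/-! ### Infinitesimal characters -/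

section Infinitesimal

open Finset WithConv

variable {K : Type*} [Field K] {A : Type*} [CommRing A] [Algebra K A]

theorem counit_apply (x : TV K) : counit K A x = algebraMap K A (counitTV K x) := rfl

theorem counit_mul (x y : TV K) : counit K A (x * y) = counit K A x * counit K A y := by
  simp [counit_apply]

theorem counit_one : counit K A 1 = 1 := by simp [counit_apply]

/-- The property of being a derivation with respect to the counit. -/
def IsCounitDerivation (φ : TV K →ₗ[K] A) : Prop :=
  ∀ x y, φ (x * y) = φ x * counit K A y + counit K A x * φ y

theorem IsCounitDerivation.map_one {φ : TV K →ₗ[K] A} (h : IsCounitDerivation φ) : φ 1 = 0 := by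
  have := h 1 1
  rw [one_mul, counit_one, mul_one, one_mul] at this
  simpa using this

theorem counit_eq_zero_of_mem_range {n : ℕ} {x : TV K}
    (hx : x ∈ LinearMap.range (TensorAlgebra.ι K (M := V K)) ^ (n + 1)) : counit K A x = 0 := by
  rw [pow_succ] at hx
  induction hx using Submodule.mul_induction_on' with
  | mem_mul_mem y _ z hz =>
    obtain ⟨v, rfl⟩ := hz
    rw [counit_mul, counit_apply (TensorAlgebra.ι K v)]
    simp [TensorAlgebra.algebraMapInv]
  | add y _ z _ hy hz => rw [map_add, hy, hz, add_zero]

theorem IsCounitDerivation.mem_L {φ : TV K →ₗ[K] A} (h : IsCounitDerivation φ) : φ ∈ L K A := by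
  refine ⟨h.map_one, fun n hn x hx => ?_⟩
  obtain ⟨n, rfl⟩ := Nat.exists_eq_add_of_le' hn
  rw [show n + 2 = (n + 1) + 1 from rfl, pow_succ] at hx
  induction hx using Submodule.mul_induction_on' with
  | mem_mul_mem y hy z hz =>
    rw [← pow_one (LinearMap.range _)] at hz
    rw [h, counit_eq_zero_of_mem_range hy, counit_eq_zero_of_mem_range (n := 0) hz]
    simp
  | add y _ z _ hy hz => rw [map_add, hy, hz, add_zero]

theorem exists_wordProd_mem_range_pow (l : List (List ℕ+)) :
    ∃ n, wordProd K l ∈ LinearMap.range (TensorAlgebra.ι K (M := V K)) ^ n := by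
  induction l with
  | nil => exact ⟨0, by rw [pow_zero]; exact Submodule.mem_one.mpr ⟨1, map_one _⟩⟩
  | cons u l ih =>
    obtain ⟨n, hn⟩ := ih
    rw [wordProd_cons]
    cases u with
    | nil => exact ⟨n, by rwa [word_nil, one_mul]⟩
    | cons a w =>
      refine ⟨n + 1, ?_⟩
      rw [pow_succ']
      exact Submodule.mul_mem_mul ⟨_, rfl⟩ hn

/-- Each product of words lies in a single tensor power of `V`, and outside `V` itself elements of
`L(A)` have no freedom. -/
theorem L_ext {φ ψ : TV K →ₗ[K] A} (hφ : φ ∈ L K A) (hψ : ψ ∈ L K A)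
    (h : ∀ w, φ (word K w) = ψ (word K w)) : φ = ψ := by
  refine eq_of_eq_on_wordProd fun l => ?_
  obtain ⟨n, hn⟩ := exists_wordProd_mem_range_pow (K := K) l
  match n, hn with
  | 0, hn =>
    rw [pow_zero, Submodule.mem_one] at hn
    obtain ⟨c, hc⟩ := hn
    rw [← hc, Algebra.algebraMap_eq_smul_one, map_smul, map_smul, hφ.1, hψ.1]
  | 1, hn =>
    rw [pow_one] at hn
    obtain ⟨v, hv⟩ := hn
    rw [← hv]
    have : φ ∘ₗ TensorAlgebra.ι K = ψ ∘ₗ TensorAlgebra.ι K := by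
      refine Finsupp.lhom_ext' fun w => LinearMap.ext_ring ?_
      obtain ⟨w, hw⟩ := w
      cases w with
      | nil => exact absurd rfl hw
      | cons a w => exact h (a :: w)
    exact DFunLike.congr_fun this v
  | n + 2, hn => rw [hφ.2 _ (by omega) _ hn, hψ.2 _ (by omega) _ hn]

variable (K) in
/-- The algebra morphism `ε + f` to the dual numbers over `A`, where `f` is the infinitesimal
character with given values at the words. -/
def dualCharacter (f : List ℕ+ → A) : TV K →ₐ[K] TrivSqZeroExt A A :=
  TensorAlgebra.lift K (Finsupp.linearCombination K fun w => TrivSqZeroExt.inr (f w.1))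

theorem fst_dualCharacter (f : List ℕ+ → A) (x : TV K) :
    (dualCharacter K f x).fst = counit K A x := by
  have : (TrivSqZeroExt.fstHom K A A).comp (dualCharacter K f) =
      (Algebra.ofId K A).comp (counitTV K) := by
    refine algHom_ext_word K fun w => ?_
    cases w with
    | nil => simp [word_nil]
    | cons a w => simp [dualCharacter, word, TensorAlgebra.algebraMapInv]
  exact DFunLike.congr_fun this x

variable (K) in
/-- The infinitesimal character with given values at the words. -/
def infinitesimal (f : List ℕ+ → A) : TV K →ₗ[K] A :=
  (TrivSqZeroExt.sndHom A A).restrictScalars K ∘ₗ (dualCharacter K f).toLinearMap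

theorem infinitesimal_isCounitDerivation (f : List ℕ+ → A) :
    IsCounitDerivation (infinitesimal K f) := fun x y => by
  simp only [infinitesimal, LinearMap.comp_apply, AlgHom.toLinearMap_apply, map_mul,
    LinearMap.restrictScalars_apply, TrivSqZeroExt.sndHom_apply, TrivSqZeroExt.snd_mul,
    fst_dualCharacter, smul_eq_mul, MulOpposite.smul_eq_mul_unop, MulOpposite.unop_op]
  ring

theorem infinitesimal_word {f : List ℕ+ → A} (h : f [] = 0) (w : List ℕ+) :
    infinitesimal K f (word K w) = f w := by
  cases w with
  | nil => rw [h]; exact (infinitesimal_isCounitDerivation f).map_one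
  | cons a w => simp [infinitesimal, dualCharacter, word]

/-- The derivation built from dual numbers with the same values on words lies in `L(A)`, so it is
`φ` by `L_ext`. -/
theorem isCounitDerivation_of_mem_L {φ : TV K →ₗ[K] A} (h : φ ∈ L K A) :
    IsCounitDerivation φ := by
  have : φ = infinitesimal K fun w => φ (word K w) :=
    L_ext h (infinitesimal_isCounitDerivation _).mem_L fun w =>
      (infinitesimal_word (f := fun w => φ (word K w)) h.1 w).symm
  rw [this]
  exact infinitesimal_isCounitDerivation _

theorem LambdaLie_bijective : Function.Bijective (LambdaLie K A) := by
  constructor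
  · intro φ ψ h
    exact Subtype.ext (L_ext φ.2 ψ.2 fun w =>
      congrFun (congrArg Subtype.val h : (LambdaLie K A φ : NCSeries A) = LambdaLie K A ψ) w)
  · intro f
    refine ⟨⟨infinitesimal K f.1, (infinitesimal_isCounitDerivation _).mem_L⟩, Subtype.ext ?_⟩
    funext w
    exact infinitesimal_word f.2 w

/-! ### Convolution of infinitesimal characters -/

/-- `m_A (φ ⊗ ψ)`. -/
def tensorEval (φ ψ : TV K →ₗ[K] A) : TV K ⊗[K] TV K →ₗ[K] A :=
  LinearMap.mul' K A ∘ₗ TensorProduct.map φ ψ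

theorem tensorEval_tmul (φ ψ : TV K →ₗ[K] A) (x y : TV K) :
    tensorEval φ ψ (x ⊗ₜ y) = φ x * ψ y := rfl

theorem tensorEval_mul {φ ψ : TV K →ₗ[K] A} (hφ : IsCounitDerivation φ)
    (hψ : IsCounitDerivation ψ) (s t : TV K ⊗[K] TV K) :
    tensorEval φ ψ (s * t) =
      tensorEval φ ψ s * tensorEval (counit K A) (counit K A) t +
      tensorEval φ (counit K A) s * tensorEval (counit K A) ψ t +
      tensorEval (counit K A) ψ s * tensorEval φ (counit K A) t +
      tensorEval (counit K A) (counit K A) s * tensorEval φ ψ t := by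
  induction s with
  | zero => simp
  | add s s' hs hs' => simp only [add_mul, map_add, hs, hs']; ring
  | tmul a b =>
    induction t with
    | zero => simp
    | add t t' ht ht' => simp only [mul_add, map_add, ht, ht']; ring
    | tmul c d =>
      rw [Algebra.TensorProduct.tmul_mul_tmul]
      simp only [tensorEval_tmul, hφ a c, hψ b d]
      ring

theorem conv_apply (φ ψ : TV K →ₗ[K] A) (x : TV K) : conv φ ψ x = tensorEval φ ψ (delta K x) := rfl

theorem conv_counit (φ : TV K →ₗ[K] A) : conv φ (counit K A) = φ :=
  congrArg ofConv (mul_one (toConv φ))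

theorem counit_conv (φ : TV K →ₗ[K] A) : conv (counit K A) φ = φ :=
  congrArg ofConv (one_mul (toConv φ))

/-- The failure of `conv φ ψ` to be a derivation is symmetric in `φ` and `ψ`, so it cancels in the
commutator. -/
theorem conv_mul_apply {φ ψ : TV K →ₗ[K] A} (hφ : IsCounitDerivation φ)
    (hψ : IsCounitDerivation ψ) (x y : TV K) :
    conv φ ψ (x * y) = conv φ ψ x * counit K A y + φ x * ψ y + ψ x * φ y +
      counit K A x * conv φ ψ y := by
  rw [conv_apply, map_mul, tensorEval_mul hφ hψ]
  simp only [← conv_apply, conv_counit, counit_conv]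

theorem conv_sub_conv_mem_L {φ ψ : TV K →ₗ[K] A} (hφ : φ ∈ L K A) (hψ : ψ ∈ L K A) :
    conv φ ψ - conv ψ φ ∈ L K A := by
  have hφ' := isCounitDerivation_of_mem_L hφ
  have hψ' := isCounitDerivation_of_mem_L hψ
  refine IsCounitDerivation.mem_L fun x y => ?_
  simp only [LinearMap.sub_apply, conv_mul_apply hφ' hψ', conv_mul_apply hψ' hφ']
  ring

/-- All gaps but the first must be empty, so a prefix is cut off and the subword is the remaining
suffix. -/
theorem cutSum_head_counit (w : List ℕ+) : ∀ f γ : NCSeries A,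
    cutSum w (fun s g => f s * (γ (g.headD []) * counit K A (wordProd K g.tail))) =
      NCSeries.cauchy γ f w := by
  induction w with
  | nil => intro f γ; simp [cutSum, NCSeries.cauchy_nil, wordProd_nil, counit_one, mul_comm]
  | cons a w ih =>
    intro f γ
    rw [cutSum, NCSeries.cauchy_cons]
    congr 1
    · rw [← cutSum_counitTV K w fun s => γ [] * f (a :: s)]
      refine cutSum_congr w fun s g _ _ => ?_
      rw [List.headD_cons, List.tail_cons, counit_apply, Algebra.smul_def]
      ring
    · rw [← ih]
      refine cutSum_congr w fun s g hg _ => ?_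
      obtain ⟨u, g, rfl⟩ := List.exists_cons_of_ne_nil hg
      rfl

/-- `ψ` kills a product of two nonempty words, so at most one gap `v` is nonempty, and `w = u v u'`
with subword `u u'`. In the induction, a first letter in the gap means insertion at the beginning,
otherwise it is stripped from `f`. -/
theorem cutSum_infinitesimal {ψ : TV K →ₗ[K] A} (hψ : IsCounitDerivation ψ) (w : List ℕ+) :
    ∀ f : NCSeries A, cutSum w (fun s g => f s * ψ (wordProd K g)) =
      NCSeries.preLie f (Lambda K A ψ) w := by
  induction w with
  | nil =>
    intro f
    simp [cutSum, NCSeries.preLie, wordProd_singleton]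
    rfl
  | cons a w ih =>
    intro f
    rw [NCSeries.preLie_eq, NCSeries.add_apply, cutSum, add_comm]
    congr 1
    -- The insertion of the empty word contributes nothing, as `ψ` vanishes at `𝟏`.
    · rw [NCSeries.cauchy_cons, show Lambda K A ψ [] = 0 from hψ.map_one, zero_mul, zero_add,
        ← cutSum_head_counit (K := K)]
      refine cutSum_congr w fun s g hg _ => ?_
      obtain ⟨u, g, rfl⟩ := List.exists_cons_of_ne_nil hg
      rw [List.modifyHead_cons, wordProd_cons, hψ, counit_apply (word K (a :: u)),
        counitTV_word_cons, map_zero, zero_mul, add_zero]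
      rfl
    · simp only [wordProd_cons, word_nil, one_mul]
      exact ih (NCSeries.shift a f)

theorem Lambda_conv (φ : TV K →ₗ[K] A) {ψ : TV K →ₗ[K] A} (hψ : ψ ∈ L K A) :
    Lambda K A (conv φ ψ) = NCSeries.preLie (Lambda K A φ) (Lambda K A ψ) := by
  funext w
  refine Eq.trans ?_ (cutSum_infinitesimal (isCounitDerivation_of_mem_L hψ) w (Lambda K A φ))
  change conv φ ψ (word K w) = _
  rw [conv_apply, delta_word, map_cutSum]
  rfl

-- The Lie algebra of infinitesimal characters

attribute [local instance] LieRing.ofAssociativeRing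

variable (K A) in
/-- The infinitesimal characters, as a Lie subalgebra of the convolution algebra. -/
def lieL : LieSubalgebra K (ConvAlg K A) :=
  { (L K A).comap (WithConv.linearEquiv K (TV K →ₗ[K] A)).toLinearMap with
    lie_mem' := fun {φ ψ} hφ hψ => by
      change (⁅φ, ψ⁆ : ConvAlg K A).ofConv ∈ L K A
      rw [LieRing.of_associative_ring_bracket]
      exact conv_sub_conv_mem_L hφ hψ }

theorem mem_lieL {φ : ConvAlg K A} : φ ∈ lieL K A ↔ φ.ofConv ∈ L K A := Iff.rfl

variable (K A) in
/-- `Λ_Lie` as a morphism of Lie algebras. -/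
def lambdaHom : lieL K A →ₗ⁅K⁆ G0 K A where
  toFun φ := LambdaLie K A ⟨φ.1.ofConv, mem_lieL.mp φ.2⟩
  map_add' _ _ := rfl
  map_smul' _ _ := rfl
  map_lie' := fun {φ ψ} => Subtype.ext <| by
    rw [G0_lie]
    change Lambda K A (conv φ.1.ofConv ψ.1.ofConv - conv ψ.1.ofConv φ.1.ofConv) = _
    rw [map_sub, Lambda_conv _ (mem_lieL.mp ψ.2), Lambda_conv _ (mem_lieL.mp φ.2)]
    rfl

theorem lambdaHom_lift (φ ρ : lieL K A) (b : FreeLieAlgebra K (Fin 2)) :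
    lambdaHom K A (FreeLieAlgebra.lift K ![φ, ρ] b) =
      FreeLieAlgebra.lift K ![lambdaHom K A φ, lambdaHom K A ρ] b := by
  have : (lambdaHom K A).comp (FreeLieAlgebra.lift K ![φ, ρ]) =
      FreeLieAlgebra.lift K ![lambdaHom K A φ, lambdaHom K A ρ] := by
    refine FreeLieAlgebra.hom_ext fun i => ?_
    rw [LieHom.comp_apply, FreeLieAlgebra.lift_of_apply, FreeLieAlgebra.lift_of_apply]
    fin_cases i <;> rfl
  exact DFunLike.congr_fun this b

/-- Two Lie morphisms agreeing on the generators. It permits evaluating `bchLie`, of which only the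
associative image is known. -/
theorem coe_lift_lieL (φ ρ : lieL K A) (b : FreeLieAlgebra K (Fin 2)) :
    ((FreeLieAlgebra.lift K ![φ, ρ] b : lieL K A) : ConvAlg K A) =
      FreeAlgebra.lift K ![(φ : ConvAlg K A), (ρ : ConvAlg K A)] (freeLieToFree K b) := by
  have : (lieL K A).incl.comp (FreeLieAlgebra.lift K ![φ, ρ]) =
      (FreeAlgebra.lift K ![(φ : ConvAlg K A), (ρ : ConvAlg K A)]).toLieHom.comp
        (freeLieToFree K) := by
    refine FreeLieAlgebra.hom_ext fun i => ?_
    rw [LieHom.comp_apply, LieHom.comp_apply, FreeLieAlgebra.lift_of_apply, freeLieToFree_of]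
    refine Eq.trans ?_ (FreeAlgebra.lift_ι_apply _ _).symm
    fin_cases i <;> rfl
  exact DFunLike.congr_fun this b

/-- Membership is tested pointwise, and at each point the sum equals a partial sum. -/
theorem SumsTo.mem_lieL {u : ℕ → ConvAlg K A} {s : ConvAlg K A}
    (h : SumsTo (lengthFiltration K A) u s) (hu : ∀ n, u n ∈ lieL K A) : s ∈ lieL K A := by
  refine ShiftedBCH.mem_lieL.mpr ⟨?_, ?_⟩
  · obtain ⟨N, hN⟩ := h.apply_eq 1
    rw [hN]
    exact Finset.sum_eq_zero fun n _ => (hu n).1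
  · intro m hm x hx
    obtain ⟨N, hN⟩ := h.apply_eq x
    rw [hN]
    exact Finset.sum_eq_zero fun n _ => (hu n).2 m hm x hx

end Infinitesimal

/-! ### The group laws -/

section GroupLaw

open Finset WithConv

attribute [local instance] LieRing.ofAssociativeRing

variable {K : Type*} [Field K] {A : Type*} [CommRing A] [Algebra K A]

variable (K A) in
/-- The group-like element `exp^*(φ)` of the convolution algebra. -/
def expL (φ : L K A) : ConvAlg K A := toConv (expConv (φ : TV K →ₗ[K] A))

theorem isExp_expL (φ : L K A) :
    IsExp (lengthFiltration K A) (toConv (φ : TV K →ₗ[K] A)) (expL K A φ) :=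
  isExp_expConv φ.2.1

theorem L_mem_one (φ : L K A) : toConv (φ : TV K →ₗ[K] A) ∈ lengthFiltration K A 1 :=
  mem_lengthFiltration_one φ.2.1

theorem expL_mul_sub_one_mem (φ ρ : L K A) :
    expL K A φ * expL K A ρ - 1 ∈ lengthFiltration K A 1 := by
  have := (lengthFiltration_isFiltration K A).mul_sub_mul_mem (isExp_expL φ).sub_one_mem
    (isExp_expL ρ).sub_one_mem
  rwa [mul_one] at this

theorem expL_zero : expL K A 0 = 1 :=
  SumsTo.unique (lengthFiltration_isFiltration K A) (isExp_expL 0)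
    (isExp_zero (lengthFiltration_isFiltration K A))

/-- `log^*(exp^*(φ) * exp^*(ρ))`. -/
def bchConv (φ ρ : L K A) : TV K →ₗ[K] A :=
  logConv (conv (expConv (φ : TV K →ₗ[K] A)) (expConv (ρ : TV K →ₗ[K] A)))

theorem isLog_bchConv (φ ρ : L K A) :
    IsLog (lengthFiltration K A) (expL K A φ * expL K A ρ - 1) (toConv (bchConv φ ρ)) :=
  isLog_logConv (expL_mul_sub_one_mem φ ρ)

variable [CharZero K]

theorem expL_injective : Function.Injective (expL K A) := fun φ ψ h => by
  have hI := lengthFiltration_isFiltration K A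
  have h1 := (isExp_expL φ).isLog hI (L_mem_one φ)
  rw [h] at h1
  exact Subtype.ext (toConv_injective
    (SumsTo.unique hI h1 ((isExp_expL ψ).isLog hI (L_mem_one ψ))))

/-- An infinitesimal character as an element of the Lie subalgebra of the convolution algebra. -/
def toLieL (φ : L K A) : lieL K A := ⟨toConv (φ : TV K →ₗ[K] A), φ.2⟩

/-- The reason why `log^*(exp^*(φ) * exp^*(ρ))` is infinitesimal: every term is a Lie polynomial in
`φ` and `ρ`. -/
theorem sumsTo_bchConv (φ ρ : L K A) :
    SumsTo (lengthFiltration K A) (fun n =>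
      ((FreeLieAlgebra.lift K ![toLieL φ, toLieL ρ] (bchLie K n) : lieL K A) : ConvAlg K A))
      (toConv (bchConv φ ρ)) := by
  have hI := lengthFiltration_isFiltration K A
  refine (IsLog.sumsTo_bchAssoc hI (e := expL K A φ) (f := expL K A ρ)
    (FreeAlgebra.lift K ![(toLieL φ : ConvAlg K A), (toLieL ρ : ConvAlg K A)]) ?_ ?_
    (isLog_bchConv φ ρ)).congr fun n => ?_
  · rw [FreeAlgebra.lift_ι_apply]
    exact isExp_expL φ
  · rw [FreeAlgebra.lift_ι_apply]
    exact isExp_expL ρ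
  · rw [coe_lift_lieL, freeLieToFree_bchLie]

/-- The law `BCH(φ, ρ) = log^*(exp^*(φ) * exp^*(ρ))` on the infinitesimal characters. -/
def bchL (φ ρ : L K A) : L K A :=
  ⟨bchConv φ ρ, SumsTo.mem_lieL (sumsTo_bchConv φ ρ) fun _ => SetLike.coe_mem _⟩

theorem expL_bchL (φ ρ : L K A) : expL K A (bchL φ ρ) = expL K A φ * expL K A ρ := by
  have hI := lengthFiltration_isFiltration K A
  have h := (isLog_bchConv φ ρ).isExp hI (expL_mul_sub_one_mem φ ρ)
  rw [add_sub_cancel] at h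
  exact SumsTo.unique hI (isExp_expL (bchL φ ρ)) h

theorem expL_mul_expL_of_add_eq_zero {φ ρ : L K A} (h : φ + ρ = 0) :
    expL K A φ * expL K A ρ = 1 := by
  have hI := lengthFiltration_isFiltration K A
  have h0 : toConv (φ : TV K →ₗ[K] A) + toConv (ρ : TV K →ₗ[K] A) = 0 :=
    congrArg (fun φ : L K A => toConv (φ : TV K →ₗ[K] A)) h
  have hc : Commute (toConv (φ : TV K →ₗ[K] A)) (toConv (ρ : TV K →ₗ[K] A)) := by
    rw [eq_neg_of_add_eq_zero_right h0]
    exact (Commute.refl _).neg_right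
  have h1 := IsExp.add_of_commute hI hc (L_mem_one φ) (L_mem_one ρ) (isExp_expL φ) (isExp_expL ρ)
  rw [h0] at h1
  exact SumsTo.unique hI h1 (isExp_zero hI)

theorem isGroupLaw_bchL : IsGroupLaw (bchL (K := K) (A := A)) where
  assoc a b c := expL_injective (by simp only [expL_bchL, mul_assoc])
  exists_unit_inv := ⟨0, fun a => ⟨expL_injective (by rw [expL_bchL, expL_zero, one_mul]),
    expL_injective (by rw [expL_bchL, expL_zero, mul_one])⟩, fun a => ⟨-a,
    expL_injective (by
      rw [expL_bchL, expL_zero, expL_mul_expL_of_add_eq_zero (neg_add_cancel a)]),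
    expL_injective (by
      rw [expL_bchL, expL_zero, expL_mul_expL_of_add_eq_zero (add_neg_cancel a)])⟩⟩

theorem LambdaLie_bchL (φ ρ : L K A) :
    LambdaLie K A (bchL φ ρ) = bchG0 K (LambdaLie K A φ) (LambdaLie K A ρ) := by
  have hI := lengthFiltration_isFiltration K A
  have hs := sumsTo_bchConv φ ρ
  refine Subtype.ext (funext fun w => ?_)
  have hw : totalLength [w] < w.length + 1 := by simp [totalLength]
  have h1 := hs (w.length + 1) [w] hw
  rw [wordProd_singleton, ofConv_sub, LinearMap.sub_apply, sub_eq_zero, ofConv_sum,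
    LinearMap.sum_apply] at h1
  have h2 : ∀ n, ((FreeLieAlgebra.lift K ![LambdaLie K A φ, LambdaLie K A ρ] (bchLie K n) :
      G0 K A) : NCSeries A) w = (((FreeLieAlgebra.lift K ![toLieL φ, toLieL ρ] (bchLie K n) :
      lieL K A) : ConvAlg K A)).ofConv (word K w) := fun n =>
    congrFun (congrArg Subtype.val (lambdaHom_lift (toLieL φ) (toLieL ρ) (bchLie K n)).symm) w
  refine h1.trans ?_
  change _ = ∑ᶠ n, ((FreeLieAlgebra.lift K ![LambdaLie K A φ, LambdaLie K A ρ] (bchLie K n) :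
      G0 K A) : NCSeries A) w
  simp only [h2]
  refine (finsum_eq_sum_of_support_subset _ fun n hn => ?_).symm
  rw [Finset.coe_range, Set.mem_Iio]
  by_contra hnN
  refine hn ?_
  -- The term of degree `n` lies in step `n` of the filtration, so it vanishes at words with fewer
  -- than `n` letters.
  have := hI.antitone (not_lt.mp hnN) (hs.term_mem hI n) [w] hw
  rwa [wordProd_singleton] at this

theorem IsGroupLaw.of_surjective {X : Type*} {Y : Type*} {op : X → X → X} {op' : Y → Y → Y}
    (h : IsGroupLaw op) {f : X → Y} (hf : Function.Surjective f)
    (hop : ∀ a b, f (op a b) = op' (f a) (f b)) : IsGroupLaw op' where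
  assoc := hf.forall₃.mpr fun a b c => by simp only [← hop, h.assoc]
  exists_unit_inv := by
    obtain ⟨e, he, hinv⟩ := h.exists_unit_inv
    refine ⟨f e, hf.forall.mpr fun a => ?_, hf.forall.mpr fun a => ?_⟩
    · rw [← hop, ← hop, (he a).1, (he a).2]
      exact ⟨rfl, rfl⟩
    · obtain ⟨b, hb1, hb2⟩ := hinv a
      exact ⟨f b, by rw [← hop, hb1], by rw [← hop, hb2]⟩

end GroupLaw

end ShiftedBCH

end

/-- The first conjunct certifies that `bchLie` is a genuine choice and not its default value. -/
theorem corollary4p5 (K : Type*) [Field K] [CharZero K] (A : Type*) [CommRing A] [Algebra K A] :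
    (∀ n : ℕ, ShiftedBCH.freeLieToFree K (ShiftedBCH.bchLie K n) = ShiftedBCH.bchAssoc K n) ∧
    ∃ bchL : ShiftedBCH.L K A → ShiftedBCH.L K A → ShiftedBCH.L K A,
      (∀ φ ρ : ShiftedBCH.L K A, (bchL φ ρ : ShiftedBCH.TV K →ₗ[K] A) =
        ShiftedBCH.logConv (ShiftedBCH.conv (ShiftedBCH.expConv (φ : ShiftedBCH.TV K →ₗ[K] A))
          (ShiftedBCH.expConv (ρ : ShiftedBCH.TV K →ₗ[K] A)))) ∧
      ShiftedBCH.IsGroupLaw bchL ∧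
      ShiftedBCH.IsGroupLaw (ShiftedBCH.bchG0 K (A := A)) ∧
      Function.Bijective (ShiftedBCH.LambdaLie K A) ∧
      ∀ φ ρ : ShiftedBCH.L K A, ShiftedBCH.LambdaLie K A (bchL φ ρ) =
        ShiftedBCH.bchG0 K (ShiftedBCH.LambdaLie K A φ) (ShiftedBCH.LambdaLie K A ρ) :=
  ⟨ShiftedBCH.freeLieToFree_bchLie K, ShiftedBCH.bchL, fun _ _ => rfl,
    ShiftedBCH.isGroupLaw_bchL,
    ShiftedBCH.isGroupLaw_bchL.of_surjective ShiftedBCH.LambdaLie_bijective.2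
      ShiftedBCH.LambdaLie_bchL,
    ShiftedBCH.LambdaLie_bijective, ShiftedBCH.LambdaLie_bchL⟩
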